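/- Let $\mathcal S$ be a commutative semiring (addition $\oplus$, zero $\mathbb 0$, unit $\mathbb 1$) with a symmetry $a\mapsto\ominus a$, i.e. an additive map with $\ominus\mathbb 0=\mathbb 0$, $\ominus(ab)=(\ominus a)b=a(\ominus b)$ and $\ominus(\ominus a)=a$. Put $a\ominus b=a\oplus(\ominus b)$, $a^\circ=a\ominus a$ and $\mathcal S^\circ=\{a^\circ: a\in\mathcal S\}$; write $a\preceq b$ if $b=a\oplus c$ for some $c\in\mathcal S$, and $a\succeq^\circ b$ if $a=b\oplus c$ for some $c\in\mathcal S^\circ$. These relations are applied to (Laurent) polynomials coefficient-wise. A totally ordered idempotent semifield is a commutative semiring with idempotent addition, in which $\preceq$ is total and the invertible elements are exactly the nonzero ones; it carries the identity symmetry. Write $\mathcal S=\mathcal T$ if $\preceq$ is antisymmetric on $\mathcal S$ and there is a surjective semiring morphism $a\mapsto|a|$ from $\mathcal S$ onto a totally ordered idempotent semifield such that, for all $a,b\in\mathcal S$: (i) $|a|\prec|b|$ implies $a\oplus b=b$; (ii) if $a\preceq b$, $|a|=|b|$ and $b$ is invertible or $\mathbb 0$, then $a=b$; (iii) $a^\circ\oplus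 a^\circ=a^\circ$. For an $n\times n$ matrix $A$ let $\det(A)=\bigoplus_{\sigma}\operatorname{sign}(\sigma)\prod_i a_{i,\sigma(i)}$, where $\operatorname{sign}(\sigma)$ is $\mathbb 1$ for even and $\ominus\mathbb 1$ for odd permutations; $A$ is nonsingular if $\det(A)$ is invertible, and then $A^\nabla=\det(A)^{-1}\operatorname{adj}(A)$, where $\operatorname{adj}(A)_{i,j}=(\ominus\mathbb 1)^{i+j}\det(A_{(j,i)})$ and $A_{(j,i)}$ is $A$ with row $j$ and column $i$ deleted. Let $f_A=\det(X\mathcal I\ominus A)=\bigoplus_{k=0}^n (f_A)_kX^k$ be the formal characteristic polynomial and $f_A(x)=\det(x\mathcal I\ominus A)$ the characteristic polynomial function. The supertropical semiring is $\mathbb R\cup\mathbb R^\nu\cup\{-\infty\}$ with the identity symmetry, with $a\oplus b$ equal to the element of larger underlying value, or to $a^\nu$ if the underlying values are equal, and with product given by addition of the underlying values, a product of two finite elements being a ghost (in $\mathbb R^\nu$) if and only if at least one factor is. **Theorem.** Let $n,m\ge 0$ be integers. 1. Let $A,E\in\mathcal T^{n\times n}$. If $E$ is nonsingular, then $f_{E^\nabla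 AE}\succeq^\circ f_A$. 2. Let $A\in\mathcal T^{n\times n}$. If $A$ is nonsingular, then $f_{A^\nabla}\succeq^\circ(\ominus\mathbb 1)^n\det(A)^{-1}X^nf_A(X^{-1})$. 3. Let $A$ be an $n\times n$ matrix over a totally ordered idempotent semifield or over the supertropical semiring. Then $f_{A^m}\succeq^\circ\bigoplus_{k=0}^n(f_A)_k^m X^k$, and $f_{A^m}(x^m)\succeq^\circ(f_A(x))^m$ for every element $x$ of the semiring. -/

import Mathlib

namespace SymTrop

open Polynomial

universe u v

/-! ### Semirings with a symmetry -/

/-- A symmetry `a ↦ ⊖ a` of a semiring: an additive involution that is a left and right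
semimodule homomorphism. -/
structure Symmetry (S : Type u) [Semiring S] where
  /-- the map `a ↦ ⊖ a` -/
  neg : S → S
  neg_add : ∀ a b, neg (a + b) = neg a + neg b
  neg_zero : neg 0 = 0
  neg_mul : ∀ a b, neg (a * b) = neg a * b
  mul_neg : ∀ a b, neg (a * b) = a * neg b
  neg_neg : ∀ a, neg (neg a) = a

/-- The identity symmetry. -/
def Symmetry.id (S : Type u) [Semiring S] : Symmetry S where
  neg a := a
  neg_add _ _ := rfl
  neg_zero := rfl
  neg_mul _ _ := rfl
  mul_neg _ _ := rfl
  neg_neg _ := rfl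

section Symm

variable {S : Type u} [CommSemiring S] (τ : Symmetry S)

theorem Symmetry.neg_eq (a : S) : τ.neg a = τ.neg 1 * a := by
  rw [← τ.neg_mul, one_mul]

theorem Symmetry.neg_one_mul_neg_one : τ.neg 1 * τ.neg 1 = 1 := by
  rw [← τ.neg_mul, one_mul, τ.neg_neg]

/-- The symmetry of `S[X]` acting coefficient-wise. -/
noncomputable def Symmetry.poly : Symmetry S[X] where
  neg p := C (τ.neg 1) * p
  neg_add _ _ := mul_add _ _ _
  neg_zero := mul_zero _
  neg_mul _ _ := (mul_assoc _ _ _).symm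
  mul_neg _ _ := mul_left_comm _ _ _
  neg_neg p := by
    rw [← mul_assoc, ← C_mul, τ.neg_one_mul_neg_one, C_1, one_mul]

theorem Symmetry.coeff_poly_neg (p : S[X]) (k : ℕ) :
    (τ.poly.neg p).coeff k = τ.neg (p.coeff k) := by
  rw [τ.neg_eq (p.coeff k)]
  exact coeff_C_mul p

/-- `a° = a ⊖ a`. -/
def Symmetry.bal (a : S) : S := a + τ.neg a

/-- `a ⪰° b`: there is `c ∈ S°` with `a = b ⊕ c`, where `S° = {d° : d ∈ S}`. -/
def SuccBal (a b : S) : Prop := ∃ c ∈ Set.range τ.bal, a = b + c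

end Symm

/-- The natural preorder `a ⪯ b`: there is `c` with `b = a ⊕ c`. -/
def NatLE {S : Type u} [CommSemiring S] (a b : S) : Prop := ∃ c, b = a + c

/-- A totally ordered idempotent (commutative) semifield: addition is idempotent, the natural
order is total, and the nonzero elements are exactly the invertible ones. -/
structure IsTotallyOrderedIdempotentSemifield (M : Type v) [CommSemiring M] : Prop where
  idem : ∀ a : M, a + a = a
  total : ∀ a b : M, NatLE a b ∨ NatLE b a
  isUnit_iff : ∀ a : M, IsUnit a ↔ a ≠ 0

/-- A (generalized) extended tropical semiring: a commutative semiring with a symmetry that is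
naturally ordered and has a modulus `μ` with values in a totally ordered idempotent semifield `M`,
subject to three compatibility properties. -/
structure IsExtendedTropical {S : Type u} {M : Type v} [CommSemiring S] [CommSemiring M]
    (τ : Symmetry S) (μ : S →+* M) : Prop where
  /-- `S` is naturally ordered (reflexivity and transitivity of `⪯` are automatic). -/
  natLE_antisymm : ∀ a b : S, NatLE a b → NatLE b a → a = b
  semifield : IsTotallyOrderedIdempotentSemifield M
  surjective : Function.Surjective μ
  /-- if `|a| ≺ |b|` then `a ⊕ b = b` -/
  add_eq_of_lt : ∀ a b : S, NatLE (μ a) (μ b) → μ a ≠ μ b → a + b = b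
  /-- if `a ⪯ b`, `|a| = |b|` and `b` is invertible or zero then `a = b` -/
  eq_of_natLE : ∀ a b : S, NatLE a b → μ a = μ b → (IsUnit b ∨ b = 0) → a = b
  /-- `S°` is idempotent -/
  bal_idem : ∀ a : S, τ.bal a + τ.bal a = τ.bal a

/-! ### Determinants, quasi-inverses and characteristic polynomials -/

section Matrices

variable {S : Type u} [CommSemiring S] (τ : Symmetry S)

/-- The sign of a permutation in `S`: `1` for even and `⊖ 1` for odd permutations. -/
def permSign {n : ℕ} (σ : Equiv.Perm (Fin n)) : S :=
  if Equiv.Perm.sign σ = 1 then 1 else τ.neg 1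

/-- The determinant over a semiring with symmetry. -/
def symDet {n : ℕ} (A : Matrix (Fin n) (Fin n) S) : S :=
  ∑ σ : Equiv.Perm (Fin n), permSign τ σ * ∏ i, A i (σ i)

/-- `A` is nonsingular when its determinant is invertible in `S`. -/
def Nonsingular {n : ℕ} (A : Matrix (Fin n) (Fin n) S) : Prop := IsUnit (symDet τ A)

/-- The adjoint matrix: its `(i, j)` entry is `(⊖ 1) ^ (i + j)` times the determinant of the matrix
obtained from `A` by deleting row `j` and column `i`. -/
def adj : {n : ℕ} → Matrix (Fin n) (Fin n) S → Matrix (Fin n) (Fin n) S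
  | 0, A => A
  | _ + 1, A => Matrix.of fun i j =>
      τ.neg 1 ^ ((i : ℕ) + (j : ℕ)) * symDet τ (A.submatrix j.succAbove i.succAbove)

/-- The quasi-inverse `A^∇ = det(A)⁻¹ adj(A)` of a nonsingular matrix (`Ring.inverse` is the
inverse on invertible elements). -/
noncomputable def quasiInv {n : ℕ} (A : Matrix (Fin n) (Fin n) S) : Matrix (Fin n) (Fin n) S :=
  Ring.inverse (symDet τ A) • adj τ A

/-- The formal characteristic polynomial `f_A = det(X I ⊖ A)`. -/
noncomputable def charPoly {n : ℕ} (A : Matrix (Fin n) (Fin n) S) : S[X] :=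
  symDet τ.poly (Matrix.of fun i j =>
    (X : S[X]) * (1 : Matrix (Fin n) (Fin n) S[X]) i j + τ.poly.neg (C (A i j)))

/-- The characteristic polynomial function `f_A(x) = det(x I ⊖ A)`. -/
def charFun {n : ℕ} (A : Matrix (Fin n) (Fin n) S) (x : S) : S :=
  symDet τ (Matrix.of fun i j => x * (1 : Matrix (Fin n) (Fin n) S) i j + τ.neg (A i j))

/-- The characteristic polynomial function is the evaluation of the formal one. -/
theorem eval_charPoly {n : ℕ} (A : Matrix (Fin n) (Fin n) S) (x : S) :
    (charPoly τ A).eval x = charFun τ A x := by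
  have hC : ∀ p : S[X], (τ.poly.neg p).eval x = τ.neg (p.eval x) := by
    intro p
    rw [τ.neg_eq (p.eval x), ← eval_C_mul]
    rfl
  have hs : ∀ σ : Equiv.Perm (Fin n), (permSign τ.poly σ).eval x = permSign τ σ := by
    intro σ
    unfold permSign
    split_ifs
    · simp
    · rw [hC, eval_one]
  simp only [charPoly, charFun, symDet, eval_finsetSum, eval_mul, hs, eval_prod, Matrix.of_apply,
    eval_add, eval_X, hC, eval_C]
  refine Finset.sum_congr rfl fun σ _ => ?_
  congr 1
  refine Finset.prod_congr rfl fun i _ => ?_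
  congr 2
  by_cases h : i = σ i
  · simp [Matrix.one_apply, ← h]
  · simp [h]

/-- `P ⪰° Q` coefficient-wise, for polynomials. -/
def PolySuccBal (P Q : S[X]) : Prop := ∀ k : ℕ, SuccBal τ (P.coeff k) (Q.coeff k)

/-- `P ⪰° Q` coefficient-wise, for Laurent polynomials. -/
def LaurentSuccBal (P Q : LaurentPolynomial S) : Prop :=
  ∀ k : ℤ, SuccBal τ (P.coeff k) (Q.coeff k)

end Matrices

/-! ### The supertropical max-plus semiring -/

/-- The set `ℝ ∪ ℝ^ν ∪ {-∞}`. -/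
inductive Supertropical : Type
  | bot : Supertropical
  | tangible (a : ℝ) : Supertropical
  | ghost (a : ℝ) : Supertropical

namespace Supertropical

/-- The underlying element of `ℝ ∪ {-∞}`. -/
def val : Supertropical → WithBot ℝ
  | bot => ⊥
  | tangible a => (a : WithBot ℝ)
  | ghost a => (a : WithBot ℝ)

/-- The map `a ↦ a^ν`. -/
def nu : Supertropical → Supertropical
  | bot => bot
  | tangible a => ghost a
  | ghost a => ghost a

/-- Supertropical addition: the element of larger value, and the ghost in case of a tie. -/
noncomputable def add (a b : Supertropical) : Supertropical :=
  open scoped Classical in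
  if val b < val a then a else if val a < val b then b else nu a

/-- Supertropical multiplication: values add up, and the product is a ghost as soon as one of
the factors is. -/
noncomputable def mul : Supertropical → Supertropical → Supertropical
  | bot, _ => bot
  | _, bot => bot
  | tangible a, tangible b => tangible (a + b)
  | tangible a, ghost b => ghost (a + b)
  | ghost a, tangible b => ghost (a + b)
  | ghost a, ghost b => ghost (a + b)

noncomputable instance : Add Supertropical := ⟨add⟩
noncomputable instance : Mul Supertropical := ⟨mul⟩
instance : Zero Supertropical := ⟨bot⟩
noncomputable instance : One Supertropical := ⟨tangible 0⟩

theorem add_def (a b : Supertropical) : a + b = add a b := rfl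

theorem val_nu (a : Supertropical) : val (nu a) = val a := by cases a <;> rfl

theorem nu_nu (a : Supertropical) : nu (nu a) = nu a := by cases a <;> rfl

theorem nu_eq_of_val_eq {a b : Supertropical} (h : val a = val b) : nu a = nu b := by
  cases a <;> cases b <;> simp_all [val, nu]

theorem add_of_gt {a b : Supertropical} (h : val b < val a) : a + b = a := by
  simp [add_def, add, h]

theorem add_of_lt {a b : Supertropical} (h : val a < val b) : a + b = b := by
  simp [add_def, add, h, h.le]

theorem add_of_eq {a b : Supertropical} (h : val a = val b) : a + b = nu a := by
  simp [add_def, add, h]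

protected theorem add_comm (a b : Supertropical) : a + b = b + a := by
  rcases lt_trichotomy (val a) (val b) with h | h | h
  · rw [add_of_lt h, add_of_gt h]
  · rw [add_of_eq h, add_of_eq h.symm, nu_eq_of_val_eq h]
  · rw [add_of_lt h, add_of_gt h]

protected theorem zero_add (a : Supertropical) : 0 + a = a := by
  change bot + a = a
  cases a with
  | bot => exact add_of_eq rfl
  | tangible a => exact add_of_lt (WithBot.bot_lt_coe a)
  | ghost a => exact add_of_lt (WithBot.bot_lt_coe a)

protected theorem add_assoc (a b c : Supertropical) : a + b + c = a + (b + c) := by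
  rcases lt_trichotomy (val a) (val b) with h | h | h <;>
  rcases lt_trichotomy (val b) (val c) with h' | h' | h'
  · rw [add_of_lt h, add_of_lt h', add_of_lt (h.trans h')]
  · rw [add_of_lt h, add_of_eq h', add_of_lt (by rwa [val_nu])]
  · rw [add_of_lt h, add_of_gt h', add_of_lt h]
  · rw [add_of_eq h, add_of_lt h', add_of_lt (by rwa [val_nu, h]), add_of_lt (h ▸ h')]
  · rw [add_of_eq h, add_of_eq h', add_of_eq (by rw [val_nu, h, h']), nu_nu,
      add_of_eq (by rw [val_nu, h])]
  · rw [add_of_eq h, add_of_gt h', add_of_gt (by rwa [val_nu, h]), add_of_eq h]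
  · rw [add_of_gt h, add_of_lt h']
  · rw [add_of_gt h, add_of_eq h', add_of_gt (h' ▸ h), add_of_gt (by rwa [val_nu])]
  · rw [add_of_gt h, add_of_gt h', add_of_gt (h'.trans h), add_of_gt h]

protected theorem mul_comm (a b : Supertropical) : a * b = b * a := by
  cases a <;> cases b <;> first | rfl | (change mul _ _ = mul _ _; simp [mul, add_comm])

protected theorem mul_assoc (a b c : Supertropical) : a * b * c = a * (b * c) := by
  cases a <;> cases b <;> cases c <;> first
    | rfl
    | (change mul (mul _ _) _ = mul _ (mul _ _); simp [mul, add_assoc])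

protected theorem one_mul (a : Supertropical) : 1 * a = a := by
  change mul (tangible 0) a = a
  cases a <;> simp [mul]

protected theorem zero_mul (a : Supertropical) : 0 * a = 0 := rfl

theorem val_mul (a b : Supertropical) : val (a * b) = val a + val b := by
  change val (mul a b) = _
  cases a <;> cases b <;> simp [mul, val]

theorem mul_nu (a b : Supertropical) : a * nu b = nu (a * b) := by
  cases a <;> cases b <;> rfl

protected theorem mul_add (a b c : Supertropical) : a * (b + c) = a * b + a * c := by
  by_cases h0 : a = 0
  · subst h0
    exact (Supertropical.zero_add 0).symm
  have ha : val a ≠ ⊥ := by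
    cases a with
    | bot => exact absurd rfl h0
    | tangible a => exact WithBot.coe_ne_bot
    | ghost a => exact WithBot.coe_ne_bot
  rcases lt_trichotomy (val b) (val c) with h | h | h
  · rw [add_of_lt h, add_of_lt]
    rw [val_mul, val_mul]
    exact WithBot.add_lt_add_left ha h
  · rw [add_of_eq h, mul_nu, add_of_eq]
    rw [val_mul, val_mul, h]
  · rw [add_of_gt h, add_of_gt]
    rw [val_mul, val_mul]
    exact WithBot.add_lt_add_left ha h

noncomputable instance : CommSemiring Supertropical where
  add_assoc := Supertropical.add_assoc
  zero_add := Supertropical.zero_add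
  add_zero a := by rw [Supertropical.add_comm, Supertropical.zero_add]
  add_comm := Supertropical.add_comm
  nsmul := nsmulRec
  mul_assoc := Supertropical.mul_assoc
  one_mul := Supertropical.one_mul
  mul_one a := by rw [Supertropical.mul_comm, Supertropical.one_mul]
  mul_comm := Supertropical.mul_comm
  zero_mul := Supertropical.zero_mul
  mul_zero a := by rw [Supertropical.mul_comm, Supertropical.zero_mul]
  left_distrib := Supertropical.mul_add
  right_distrib a b c := by
    rw [Supertropical.mul_comm, Supertropical.mul_add, Supertropical.mul_comm c a,
      Supertropical.mul_comm c b]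

end Supertropical

end SymTrop

/-!
The first two claims rest on identities between integer polynomials. For generic matrices over a
commutative ring, `det(E) ^ (n - j)` times the coefficient `(f_A)_j` is the corresponding
coefficient for `adj(E) A E`, and `det(A)` times the coefficient of index `n - j` for `adj(A)` is
`(-1) ^ n det(A) ^ j (f_A)_j`. Such an identity is moved to a semiring with symmetry by writing both
sides formally, in polynomials whose coefficients are pairs `p ⊕ ⊖ q` of natural numbers: two formal
polynomials that denote the same integer polynomial both equal its cancellation-free form plus a
balanced term. Hence the left-hand side dominates the cancellation-free form of the right-hand
side. The right-hand side itself does have cancellations, and this is where the tropical hypothesis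
enters: an invertible determinant equals one of its own terms, say that of `σ`. The part
`± (∏ i, a i (σ i)) ^ N (f_A)_j` of `± det(A) ^ N (f_A)_j` has the same value as the whole, and its
monomials do not cancel (`sign_eq_of_permMatrix_add_eq`). So the cancellation-free form lies between
two equal elements, and antisymmetry of `⪯` gives the claim (`SignedPoly.succBal_eval`,
`SignedPoly.succBal_det_pow_mul_coeff_charPoly`).

For the powers, the symmetry is the identity, and the only facts about the semiring that matter are
`a ⊕ a ⊕ a = a ⊕ a` and the Frobenius identity `(a ⊕ b) ^ m = a ^ m ⊕ b ^ m` for `m ≥ 1`. By the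
first one, all terms of a sum that occur at least twice only contribute a balanced element
(`succBal_sum_filter`). Coefficients of the characteristic polynomial are traces of compound
matrices. Compound matrices are multiplicative up to terms that come in pairs
(`succBal_compound_mul`), and `tr(B ^ m)` is the sum of the `m`-th powers of the diagonal entries up
to non-constant closed walks, which occur together with their rotations (`succBal_trace_pow`).
The Frobenius identity then turns the sum of the powers into the power of the sum.
-/

open SymTrop Polynomial

namespace SymTrop

universe u v w

/-! ### Balanced elements, naturality and coefficients of the characteristic polynomial -/

section Balance

variable {S : Type u} [CommSemiring S] (τ : Symmetry S)

theorem Symmetry.bal_add (a b : S) : τ.bal (a + b) = τ.bal a + τ.bal b := by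
  simp only [Symmetry.bal, τ.neg_add]; ring

theorem Symmetry.bal_mul (a b : S) : τ.bal (a * b) = a * τ.bal b := by
  simp only [Symmetry.bal, τ.mul_neg]; ring

theorem Symmetry.bal_zero : τ.bal (0 : S) = 0 := by
  simp [Symmetry.bal, τ.neg_zero]

variable {τ}

theorem SuccBal.intro {a b : S} (c : S) (h : a = b + τ.bal c) : SuccBal τ a b :=
  ⟨_, ⟨c, rfl⟩, h⟩

theorem SuccBal.exists_bal {a b : S} (h : SuccBal τ a b) : ∃ c, a = b + τ.bal c := by
  obtain ⟨_, ⟨c, rfl⟩, h⟩ := h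
  exact ⟨c, h⟩

variable (τ) in
theorem SuccBal.refl (a : S) : SuccBal τ a a :=
  .intro 0 (by rw [τ.bal_zero, add_zero])

theorem SuccBal.of_eq {a b : S} (h : a = b) : SuccBal τ a b := h ▸ .refl τ a

theorem SuccBal.trans {a b c : S} (h : SuccBal τ a b) (h' : SuccBal τ b c) : SuccBal τ a c := by
  obtain ⟨d, rfl⟩ := h.exists_bal
  obtain ⟨e, rfl⟩ := h'.exists_bal
  exact .intro (e + d) (by rw [τ.bal_add, add_assoc])

theorem SuccBal.add {a b c d : S} (h : SuccBal τ a b) (h' : SuccBal τ c d) :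
    SuccBal τ (a + c) (b + d) := by
  obtain ⟨x, rfl⟩ := h.exists_bal
  obtain ⟨y, rfl⟩ := h'.exists_bal
  exact .intro (x + y) (by rw [τ.bal_add]; ring)

theorem SuccBal.mul_left {a b : S} (c : S) (h : SuccBal τ a b) : SuccBal τ (c * a) (c * b) := by
  obtain ⟨x, rfl⟩ := h.exists_bal
  exact .intro (c * x) (by rw [τ.bal_mul]; ring)

theorem SuccBal.mul {a b c d : S} (h : SuccBal τ a b) (h' : SuccBal τ c d) :
    SuccBal τ (a * c) (b * d) := by
  refine (h'.mul_left a).trans ?_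
  rw [mul_comm a, mul_comm b]
  exact h.mul_left d

theorem SuccBal.sum {κ : Type*} (K : Finset κ) {f g : κ → S} (h : ∀ k ∈ K, SuccBal τ (f k) (g k)) :
    SuccBal τ (∑ k ∈ K, f k) (∑ k ∈ K, g k) := by
  classical
  induction K using Finset.induction_on with
  | empty => exact .refl τ _
  | insert k K hk ih =>
    rw [Finset.sum_insert hk, Finset.sum_insert hk]
    exact (h k (Finset.mem_insert_self k K)).add
      (ih fun l hl => h l (Finset.mem_insert_of_mem hl))

end Balance

section NatLE

variable {S : Type u} [CommSemiring S]

theorem NatLE.refl (a : S) : NatLE a a := ⟨0, (add_zero a).symm⟩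

theorem NatLE.mul {a b c d : S} (h : NatLE a b) (h' : NatLE c d) : NatLE (a * c) (b * d) := by
  obtain ⟨x, rfl⟩ := h
  obtain ⟨y, rfl⟩ := h'
  exact ⟨a * y + x * c + x * y, by ring⟩

theorem NatLE.pow {a b : S} (h : NatLE a b) (m : ℕ) : NatLE (a ^ m) (b ^ m) := by
  induction m with
  | zero => simpa using NatLE.refl (1 : S)
  | succ m ih => rw [pow_succ, pow_succ]; exact ih.mul h

theorem NatLE.map {S' : Type v} [CommSemiring S'] (φ : S →+* S') {a b : S} (h : NatLE a b) :
    NatLE (φ a) (φ b) := by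
  obtain ⟨x, rfl⟩ := h
  exact ⟨φ x, map_add φ _ _⟩

end NatLE

/-- The additive inverse, as a symmetry of a commutative ring. -/
def Symmetry.ofRing (R : Type u) [CommRing R] : Symmetry R where
  neg a := -a
  neg_add := _root_.neg_add
  neg_zero := _root_.neg_zero
  neg_mul _ _ := by ring
  mul_neg _ _ := by ring
  neg_neg := _root_.neg_neg

section Naturality

variable {S : Type u} {S' : Type v} [CommSemiring S] [CommSemiring S']
  {τ : Symmetry S} {τ' : Symmetry S'} {n : ℕ}

theorem map_permSign {φ : S →+* S'} (hφ : φ (τ.neg 1) = τ'.neg 1) (σ : Equiv.Perm (Fin n)) :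
    φ (permSign τ σ) = permSign τ' σ := by
  unfold permSign
  split_ifs <;> simp [hφ]

theorem map_symDet {φ : S →+* S'} (hφ : φ (τ.neg 1) = τ'.neg 1) (A : Matrix (Fin n) (Fin n) S) :
    φ (symDet τ A) = symDet τ' (A.map φ) := by
  simp [symDet, map_permSign hφ]

theorem map_adj {φ : S →+* S'} (hφ : φ (τ.neg 1) = τ'.neg 1) (A : Matrix (Fin n) (Fin n) S) :
    (adj τ A).map φ = adj τ' (A.map φ) := by
  cases n with
  | zero => exact Subsingleton.elim _ _
  | succ n =>
    ext i j
    simp only [adj, Matrix.map_apply, Matrix.of_apply, map_mul, map_pow, hφ, map_symDet hφ]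
    rfl

theorem map_charPoly {φ : S →+* S'} (hφ : φ (τ.neg 1) = τ'.neg 1)
    (A : Matrix (Fin n) (Fin n) S) : (charPoly τ A).map φ = charPoly τ' (A.map φ) := by
  have h : mapRingHom φ (τ.poly.neg 1) = τ'.poly.neg 1 := by
    change mapRingHom φ (C (τ.neg 1) * 1) = C (τ'.neg 1) * 1
    simp [hφ]
  have h2 : ∀ p : S[X], (τ.poly.neg p).map φ = τ'.poly.neg (p.map φ) := by
    intro p
    change (C (τ.neg 1) * p).map φ = C (τ'.neg 1) * p.map φ
    simp [hφ]
  unfold charPoly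
  rw [← coe_mapRingHom, map_symDet h]
  congr 1
  ext1 i j
  simp [Matrix.map_apply, h2, Matrix.one_apply, apply_ite (Polynomial.map φ)]

end Naturality

section Ring

variable {R : Type u} [CommRing R] {n : ℕ}

theorem permSign_ofRing (σ : Equiv.Perm (Fin n)) :
    permSign (Symmetry.ofRing R) σ = ((Equiv.Perm.sign σ : ℤ) : R) := by
  unfold permSign
  rcases Int.units_eq_one_or (Equiv.Perm.sign σ) with h | h <;> simp [h, Symmetry.ofRing]

theorem symDet_ofRing (A : Matrix (Fin n) (Fin n) R) : symDet (Symmetry.ofRing R) A = A.det := by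
  rw [← Matrix.det_transpose, Matrix.det_apply']
  simp [symDet, permSign_ofRing]

theorem adj_ofRing (A : Matrix (Fin n) (Fin n) R) :
    adj (Symmetry.ofRing R) A = A.adjugate := by
  cases n with
  | zero => exact Subsingleton.elim _ _
  | succ n =>
    ext i j
    rw [Matrix.adjugate_fin_succ_eq_det_submatrix, add_comm (j : ℕ)]
    simp only [adj, Matrix.of_apply, symDet_ofRing]
    rfl

theorem charPoly_ofRing (A : Matrix (Fin n) (Fin n) R) :
    charPoly (Symmetry.ofRing R) A = A.charpoly := by
  have h : (Symmetry.ofRing R).poly = Symmetry.ofRing R[X] := by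
    have : (Symmetry.ofRing R).poly.neg = (Symmetry.ofRing R[X]).neg := by
      funext p
      change C (-1) * p = -p
      simp
    cases hp : (Symmetry.ofRing R).poly
    cases hq : Symmetry.ofRing R[X]
    simp only [hp, hq] at this
    subst this
    rfl
  rw [charPoly, h, symDet_ofRing, Matrix.charpoly]
  congr 1
  ext1 i j
  simp only [Matrix.of_apply, Matrix.charmatrix_apply, Symmetry.ofRing, Matrix.one_apply,
    Matrix.diagonal_apply]
  split_ifs <;> simp [sub_eq_add_neg]

end Ring

section Coefficients

variable {S : Type u} [CommSemiring S] {n : ℕ}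

/-- The index set of the expansion of the coefficient of `X ^ j` in a characteristic polynomial:
a permutation together with `j` of its fixed points. -/
def charTerms (n j : ℕ) : Finset (Equiv.Perm (Fin n) × Finset (Fin n)) :=
  Finset.univ.filter fun x => x.2.card = j ∧ ∀ i ∈ x.2, x.1 i = i

theorem mem_charTerms {j : ℕ} {x : Equiv.Perm (Fin n) × Finset (Fin n)} :
    x ∈ charTerms n j ↔ x.2.card = j ∧ ∀ i ∈ x.2, x.1 i = i := by
  simp [charTerms]

theorem permSign_poly (τ : Symmetry S) (σ : Equiv.Perm (Fin n)) :
    permSign τ.poly σ = C (permSign τ σ) := by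
  unfold permSign
  split_ifs
  · simp
  · exact mul_one _

/-- The expansion of a coefficient of the characteristic polynomial: expand each product over the
rows by choosing the set of rows in which `X` is taken. -/
theorem coeff_charPoly (τ : Symmetry S) (A : Matrix (Fin n) (Fin n) S) (j : ℕ) :
    (charPoly τ A).coeff j =
      ∑ x ∈ charTerms n j, permSign τ x.1 * τ.neg 1 ^ (n - j) * ∏ i ∈ x.2ᶜ, A i (x.1 i) := by
  have key : ∀ σ : Equiv.Perm (Fin n), ∀ J : Finset (Fin n),
      (∏ i ∈ J, (X : S[X]) * (1 : Matrix (Fin n) (Fin n) S[X]) i (σ i)) *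
        ∏ i ∈ Jᶜ, τ.poly.neg (C (A i (σ i))) =
      C (if ∀ i ∈ J, σ i = i then τ.neg 1 ^ (n - J.card) * ∏ i ∈ Jᶜ, A i (σ i) else 0) *
        X ^ J.card := by
    intro σ J
    have h2 : ∏ i ∈ Jᶜ, τ.poly.neg (C (A i (σ i))) =
        C (τ.neg 1 ^ (n - J.card) * ∏ i ∈ Jᶜ, A i (σ i)) := by
      change ∏ i ∈ Jᶜ, (C (τ.neg 1) * C (A i (σ i))) = _
      rw [Finset.prod_mul_distrib, Finset.prod_const, Finset.card_compl, Fintype.card_fin]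
      simp
    rw [h2, Finset.prod_mul_distrib, Finset.prod_const]
    split_ifs with h
    · rw [Finset.prod_eq_one fun i hi => by rw [h i hi, Matrix.one_apply_eq]]
      ring
    · push Not at h
      obtain ⟨i, hi, h⟩ := h
      rw [Finset.prod_eq_zero hi (by simp [Matrix.one_apply_ne (Ne.symm h)])]
      simp
  have expand : charPoly τ A = ∑ σ : Equiv.Perm (Fin n), ∑ J : Finset (Fin n),
      C (permSign τ σ) *
        (C (if ∀ i ∈ J, σ i = i then τ.neg 1 ^ (n - J.card) * ∏ i ∈ Jᶜ, A i (σ i) else 0) *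
          X ^ J.card) := by
    refine Finset.sum_congr rfl fun σ _ => ?_
    rw [permSign_poly, ← Finset.mul_sum, ← Finset.sum_congr rfl fun J _ => key σ J]
    exact congrArg _ (Fintype.prod_add _ _)
  simp only [expand, finsetSum_coeff, coeff_C_mul, coeff_X_pow]
  rw [charTerms, Finset.sum_filter, ← Finset.univ_product_univ, Finset.sum_product]
  refine Finset.sum_congr rfl fun σ _ => ?_
  refine Finset.sum_congr rfl fun J _ => ?_
  by_cases h : J.card = j
  · subst h
    simp [mul_assoc]
  · simp [h, Ne.symm h]

theorem coeff_charPoly_of_lt (τ : Symmetry S) (A : Matrix (Fin n) (Fin n) S) {j : ℕ} (hj : n < j) :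
    (charPoly τ A).coeff j = 0 := by
  rw [coeff_charPoly]
  refine Finset.sum_eq_zero fun x hx => ?_
  have := (Finset.card_le_univ x.2).trans_eq (Fintype.card_fin n)
  have := (mem_charTerms.1 hx).1
  omega

theorem coeff_charPoly_smul (τ : Symmetry S) (u : S) (A : Matrix (Fin n) (Fin n) S) (j : ℕ) :
    (charPoly τ (u • A)).coeff j = u ^ (n - j) * (charPoly τ A).coeff j := by
  rw [coeff_charPoly, coeff_charPoly, Finset.mul_sum]
  refine Finset.sum_congr rfl fun x hx => ?_
  rw [← (mem_charTerms.1 hx).1]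
  simp only [Matrix.smul_apply, smul_eq_mul, Finset.prod_mul_distrib, Finset.prod_const,
    Finset.card_compl, Fintype.card_fin]
  ring

end Coefficients

section AdjugateCharpoly

variable {R : Type u} [CommRing R] {n : ℕ}

theorem coeff_charpoly_smul (u : R) (A : Matrix (Fin n) (Fin n) R) (j : ℕ) :
    (u • A).charpoly.coeff j = u ^ (n - j) * A.charpoly.coeff j := by
  rw [← charPoly_ofRing, ← charPoly_ofRing, coeff_charPoly_smul]

theorem coeff_charpoly_adjugate_conj (A E : Matrix (Fin n) (Fin n) R) (j : ℕ) :
    (E.adjugate * A * E).charpoly.coeff j = E.det ^ (n - j) * A.charpoly.coeff j := by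
  rw [Matrix.mul_assoc, Matrix.charpoly_mul_comm, Matrix.mul_assoc, Matrix.mul_adjugate,
    Matrix.mul_smul, Matrix.mul_one, coeff_charpoly_smul]

/-- Since `A (X - adj A) = X A - det A`, the left-hand side is `(-1) ^ n` times the characteristic
polynomial of `X A`, evaluated at `det A`. -/
theorem det_mul_charpoly_adjugate (A : Matrix (Fin n) (Fin n) R) :
    C A.det * A.adjugate.charpoly =
      ∑ j ∈ Finset.range (n + 1), C ((-1) ^ n * (A.det ^ j * A.charpoly.coeff j)) * X ^ (n - j) := by
  have h1 : C A.det * A.adjugate.charpoly =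
      (-1) ^ n * ((X : R[X]) • A.map C).charpoly.eval (C A.det) := by
    have hdet : C A.det = (A.map C).det := RingHom.map_det C A
    have h2 : A.map C * A.adjugate.map C = (A.map C).det • (1 : Matrix (Fin n) (Fin n) R[X]) := by
      rw [← hdet, ← Matrix.map_mul, Matrix.mul_adjugate]
      ext1 i j
      simp [Matrix.map_apply, Matrix.one_apply, apply_ite (C : R → R[X])]
    have hneg : ∀ M : Matrix (Fin n) (Fin n) R[X], (-M).det = (-1) ^ n * M.det := by
      intro M
      rw [Matrix.det_neg, Fintype.card_fin]
    rw [Matrix.eval_charpoly, ← hneg, hdet, Matrix.charpoly, ← Matrix.det_mul]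
    congr 1
    rw [Matrix.charmatrix, RingHom.mapMatrix_apply, Matrix.mul_sub, h2,
      Matrix.scalar_apply, Matrix.scalar_apply, ← Matrix.smul_one_eq_diagonal,
      ← Matrix.smul_one_eq_diagonal, Matrix.mul_smul, Matrix.mul_one, neg_sub]
  rw [h1, eval_eq_sum_range' (n := n + 1), Finset.mul_sum]
  · refine Finset.sum_congr rfl fun j _ => ?_
    rw [coeff_charpoly_smul,
      show (A.map (C : R → R[X])).charpoly = A.charpoly.map C from Matrix.charpoly_map A C,
      coeff_map]
    simp only [map_mul, map_pow, map_neg, map_one]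
    ring
  · rw [Nat.lt_succ_iff, natDegree_le_iff_coeff_eq_zero]
    intro k hk
    rw [← charPoly_ofRing, coeff_charPoly_of_lt _ _ hk]

theorem det_mul_coeff_charpoly_adjugate (A : Matrix (Fin n) (Fin n) R) {j : ℕ} (hj : j ≤ n) :
    A.det * A.adjugate.charpoly.coeff (n - j) = (-1) ^ n * (A.det ^ j * A.charpoly.coeff j) := by
  rw [← coeff_C_mul, det_mul_charpoly_adjugate, finsetSum_coeff]
  simp only [coeff_C_mul_X_pow]
  rw [Finset.sum_eq_single_of_mem j (by simp; omega)]
  · simp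
  · intro k hk hkj
    rw [Finset.mem_range] at hk
    rw [if_neg (by omega)]

end AdjugateCharpoly

/-! ### Formal polynomials with signs and the transfer principle -/

/-- The free commutative semiring with symmetry on one element: natural combinations `p ⊕ ⊖ q`,
encoded as the semigroup algebra of the two signs. -/
abbrev SignedNat : Type := MonoidAlgebra ℕ ℤˣ

namespace SignedNat

/-- A sign, as a signed natural number. -/
noncomputable def sgn : ℤˣ →* SignedNat := MonoidAlgebra.of ℕ ℤˣ

/-- The difference `p - q` of a signed natural number `p ⊕ ⊖ q`. -/
noncomputable def toInt : SignedNat →+* ℤ :=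
  (MonoidAlgebra.lift ℕ ℤ ℤˣ (Units.coeHom ℤ)).toRingHom

theorem toInt_sgn (s : ℤˣ) : toInt (sgn s) = s :=
  MonoidAlgebra.lift_of _ _

/-- The reduced signed natural number with a given difference. -/
noncomputable def ofInt (z : ℤ) : SignedNat := z.toNat • sgn 1 + (-z).toNat • sgn (-1)

theorem ofInt_zero : ofInt 0 = 0 := by simp [ofInt]

/-- A signed natural number without cancellation is reduced. -/
theorem ofInt_toInt_nsmul_sgn (N : ℕ) (s : ℤˣ) : ofInt (toInt (N • sgn s)) = N • sgn s := by
  rw [map_nsmul, toInt_sgn]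
  rcases Int.units_eq_one_or s with rfl | rfl <;> simp [ofInt]

theorem exists_eq_nsmul (a : SignedNat) : ∃ p q : ℕ, a = p • sgn 1 + q • sgn (-1) := by
  induction a using MonoidAlgebra.induction_on with
  | of s =>
    rcases Int.units_eq_one_or s with rfl | rfl
    · exact ⟨1, 0, by simp [sgn]⟩
    · exact ⟨0, 1, by simp [sgn]⟩
  | add a b ha hb =>
    obtain ⟨p, q, rfl⟩ := ha
    obtain ⟨p', q', rfl⟩ := hb
    exact ⟨p + p', q + q', by simp only [add_smul]; abel⟩
  | smul r a ha =>
    obtain ⟨p, q, rfl⟩ := ha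
    exact ⟨r * p, r * q, by simp only [smul_add, mul_smul]⟩

theorem exists_eq_ofInt_toInt_add (a : SignedNat) :
    ∃ c, a = ofInt (toInt a) + (1 + sgn (-1)) * c := by
  obtain ⟨p, q, rfl⟩ := exists_eq_nsmul a
  refine ⟨(min p q) • 1, ?_⟩
  have h : toInt (p • sgn 1 + q • sgn (-1)) = p - q := by
    rw [map_add, map_nsmul, map_nsmul, toInt_sgn, toInt_sgn]
    simp [sub_eq_add_neg]
  obtain ⟨r, rfl⟩ | ⟨r, rfl⟩ : (∃ r, p = q + r) ∨ ∃ r, q = p + r := by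
    rcases le_total q p with h | h
    exacts [.inl ⟨p - q, by omega⟩, .inr ⟨q - p, by omega⟩]
  · have e1 : (((q + r : ℕ) : ℤ) - (q : ℤ)).toNat = r := by omega
    have e2 : (-(((q + r : ℕ) : ℤ) - (q : ℤ))).toNat = 0 := by omega
    rw [h, ofInt, e1, e2, map_one, min_eq_right (by omega)]
    simp only [add_smul, nsmul_eq_mul]
    push_cast
    ring
  · have e1 : ((p : ℤ) - ((p + r : ℕ) : ℤ)).toNat = 0 := by omega
    have e2 : (-((p : ℤ) - ((p + r : ℕ) : ℤ))).toNat = r := by omega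
    rw [h, ofInt, e1, e2, map_one, min_eq_left (by omega)]
    simp only [add_smul, nsmul_eq_mul]
    push_cast
    ring

section Eval

variable {S : Type u} [CommSemiring S] (τ : Symmetry S)

/-- The interpretation of signs in a semiring with symmetry. -/
def signHom : ℤˣ →* S where
  toFun s := if s = 1 then 1 else τ.neg 1
  map_one' := if_pos rfl
  map_mul' s t := by
    rcases Int.units_eq_one_or s with rfl | rfl <;> rcases Int.units_eq_one_or t with rfl | rfl <;>
      simp [τ.neg_one_mul_neg_one]

theorem signHom_neg_one : signHom τ (-1) = τ.neg 1 := rfl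

/-- The interpretation of signed natural numbers in a semiring with symmetry. -/
noncomputable def eval : SignedNat →+* S :=
  (MonoidAlgebra.lift ℕ S ℤˣ (signHom τ)).toRingHom

theorem eval_sgn (s : ℤˣ) : eval τ (sgn s) = signHom τ s :=
  MonoidAlgebra.lift_of _ _

end Eval

end SignedNat

open SignedNat

/-- Formal polynomials with signed natural coefficients: expressions in the variables `ι` in the
language of semirings with symmetry. -/
abbrev SignedPoly (ι : Type w) : Type w := MvPolynomial ι SignedNat

namespace SignedPoly

variable {ι : Type w}

/-- The symmetry of formal polynomials. -/
noncomputable def symm (ι : Type w) : Symmetry (SignedPoly ι) where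
  neg p := MvPolynomial.C (sgn (-1)) * p
  neg_add _ _ := mul_add _ _ _
  neg_zero := mul_zero _
  neg_mul _ _ := (mul_assoc _ _ _).symm
  mul_neg _ _ := mul_left_comm _ _ _
  neg_neg p := by
    rw [← mul_assoc, ← MvPolynomial.C_mul, ← map_mul, neg_mul_neg, one_mul, map_one,
      MvPolynomial.C_1, one_mul]

theorem symm_neg_one : (symm ι).neg 1 = MvPolynomial.C (sgn (-1)) := mul_one _

/-- The integer polynomial denoted by a formal polynomial. -/
noncomputable def toInt : SignedPoly ι →+* MvPolynomial ι ℤ := MvPolynomial.map SignedNat.toInt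

theorem toInt_neg_one : toInt ((symm ι).neg 1) = (Symmetry.ofRing (MvPolynomial ι ℤ)).neg 1 := by
  rw [symm_neg_one, toInt, MvPolynomial.map_C, toInt_sgn]
  simp [Symmetry.ofRing]

/-- The formal polynomial without cancellations that denotes a given integer polynomial. -/
noncomputable def ofInt (z : MvPolynomial ι ℤ) : SignedPoly ι :=
  ∑ m ∈ z.support, MvPolynomial.monomial m (SignedNat.ofInt (z.coeff m))

theorem coeff_ofInt (z : MvPolynomial ι ℤ) (m : ι →₀ ℕ) :
    (ofInt z).coeff m = SignedNat.ofInt (z.coeff m) := by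
  classical
  simp only [ofInt, MvPolynomial.coeff_sum, MvPolynomial.coeff_monomial]
  rw [Finset.sum_ite_eq' z.support m fun m => SignedNat.ofInt (z.coeff m)]
  split_ifs with h
  · rfl
  · rw [MvPolynomial.notMem_support_iff.1 h, SignedNat.ofInt_zero]

theorem exists_eq_add_of_coeff {P Q : SignedPoly ι} (b : SignedNat)
    (h : ∀ m, ∃ c, P.coeff m = Q.coeff m + b * c) : ∃ R, P = Q + MvPolynomial.C b * R := by
  classical
  choose c hc using h
  refine ⟨∑ m ∈ P.support ∪ Q.support, MvPolynomial.monomial m (c m), ?_⟩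
  ext1 m
  rw [MvPolynomial.coeff_add, MvPolynomial.coeff_C_mul, MvPolynomial.coeff_sum]
  simp only [MvPolynomial.coeff_monomial]
  rw [Finset.sum_ite_eq' _ m c]
  split_ifs with h
  · exact hc m
  · rw [Finset.mem_union, not_or, MvPolynomial.notMem_support_iff,
      MvPolynomial.notMem_support_iff] at h
    rw [h.1, h.2, mul_zero, zero_add]

theorem exists_eq_ofInt_toInt_add (P : SignedPoly ι) :
    ∃ R, P = ofInt (toInt P) + MvPolynomial.C (1 + sgn (-1)) * R := by
  refine exists_eq_add_of_coeff _ fun m => ?_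
  rw [coeff_ofInt, toInt, MvPolynomial.coeff_map]
  exact SignedNat.exists_eq_ofInt_toInt_add _

section Eval

variable {S : Type u} [CommSemiring S] (τ : Symmetry S) (x : ι → S)

/-- The value of a formal polynomial in a semiring with symmetry. -/
noncomputable def eval : SignedPoly ι →+* S := MvPolynomial.eval₂Hom (SignedNat.eval τ) x

theorem eval_X (i : ι) : eval τ x (MvPolynomial.X i) = x i := MvPolynomial.eval₂Hom_X' _ _ _

theorem eval_C (a : SignedNat) : eval τ x (MvPolynomial.C a) = SignedNat.eval τ a :=
  MvPolynomial.eval₂Hom_C _ _ _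

theorem eval_neg_one : eval τ x ((symm ι).neg 1) = τ.neg 1 := by
  rw [symm_neg_one, eval_C, eval_sgn, signHom_neg_one]

theorem eval_balanced_mul (R : SignedPoly ι) :
    eval τ x (MvPolynomial.C (1 + sgn (-1)) * R) = τ.bal (eval τ x R) := by
  rw [map_mul, eval_C, map_add, map_one, eval_sgn, signHom_neg_one, add_mul, one_mul,
    ← τ.neg_eq]
  rfl

variable {τ x}

/-- The transfer principle: if the formal polynomials `P` and `Q` denote the same integer
polynomial, then `P ⪰° Q` holds at every point at which the value of `Q` is already attained by
a part `Q₁` of `Q` whose monomials suffer no cancellation in `Q`. -/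
theorem succBal_eval (anti : ∀ a b : S, NatLE a b → NatLE b a → a = b)
    {κ : Type v} [DecidableEq κ] (K K₁ : Finset κ) (hK : K₁ ⊆ K) (e : κ → ι →₀ ℕ) (s : κ → ℤˣ)
    (hs : ∀ k ∈ K₁, ∀ l ∈ K, e k = e l → s k = s l) {P Q : SignedPoly ι}
    (hQ : Q = ∑ k ∈ K, MvPolynomial.monomial (e k) (sgn (s k))) (hPQ : toInt P = toInt Q)
    (hx : eval τ x (∑ k ∈ K₁, MvPolynomial.monomial (e k) (sgn (s k))) = eval τ x Q) :
    SuccBal τ (eval τ x P) (eval τ x Q) := by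
  classical
  set Q₁ : SignedPoly ι := ∑ k ∈ K₁, MvPolynomial.monomial (e k) (sgn (s k)) with hQ₁
  obtain ⟨R, hR⟩ := exists_eq_ofInt_toInt_add P
  obtain ⟨R', hR'⟩ := exists_eq_ofInt_toInt_add Q
  have hQ₁Q : Q = Q₁ + ∑ k ∈ K \ K₁, MvPolynomial.monomial (e k) (sgn (s k)) := by
    rw [hQ, hQ₁, add_comm, Finset.sum_sdiff hK]
  have hcoeff : ∀ m, ∃ c, (ofInt (toInt Q)).coeff m = Q₁.coeff m + 1 * c := by
    intro m
    rw [coeff_ofInt, toInt, MvPolynomial.coeff_map]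
    by_cases h : ∃ k ∈ K₁, e k = m
    · obtain ⟨k, hk, rfl⟩ := h
      -- all the terms of `Q` with the exponent of `k` have the sign of `k`
      have h1 : Q.coeff (e k) = (K.filter fun l => e l = e k).card • sgn (s k) := by
        simp only [hQ, MvPolynomial.coeff_sum, MvPolynomial.coeff_monomial]
        rw [← Finset.sum_filter, Finset.sum_congr rfl fun l hl => by
          rw [← hs k hk l (Finset.mem_filter.1 hl).1 (Finset.mem_filter.1 hl).2.symm]]
        rw [Finset.sum_const]
      rw [h1, ofInt_toInt_nsmul_sgn, ← h1, hQ₁Q, MvPolynomial.coeff_add]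
      exact ⟨_, by rw [one_mul]⟩
    · have h1 : Q₁.coeff m = 0 := by
        simp only [hQ₁, MvPolynomial.coeff_sum, MvPolynomial.coeff_monomial]
        exact Finset.sum_eq_zero fun k hk => if_neg fun he => h ⟨k, hk, he⟩
      exact ⟨_, by rw [h1, zero_add, one_mul]⟩
  obtain ⟨R₁, hR₁⟩ := exists_eq_add_of_coeff 1 hcoeff
  have h1 : NatLE (eval τ x Q₁) (eval τ x (ofInt (toInt Q))) := NatLE.map _ ⟨_, hR₁⟩
  have h2 : NatLE (eval τ x (ofInt (toInt Q))) (eval τ x Q) := NatLE.map _ ⟨_, hR'⟩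
  have h3 : eval τ x (ofInt (toInt Q)) = eval τ x Q := anti _ _ h2 (hx ▸ h1)
  refine .intro (eval τ x R) ?_
  rw [← eval_balanced_mul, ← h3, ← hPQ, ← map_add, ← hR]

end Eval

end SignedPoly

/-! ### Cancellation in powers of the determinant -/

/-- If the permutation matrices of the `g k` and of `π'` add up to the same matrix as those of `ρ`
and of `#t` copies of `σ`, then the products of the signs agree. -/
theorem sign_eq_of_permMatrix_add_eq {α κ : Type*} [Fintype α] [DecidableEq α] (t : Finset κ)
    (σ π' : Equiv.Perm α) (g : κ → Equiv.Perm α) :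
    ∀ ρ : Equiv.Perm α,
    (∀ a b, (t.card * if σ a = b then 1 else 0) + (if ρ a = b then 1 else 0) =
      (∑ k ∈ t, if g k a = b then 1 else 0) + if π' a = b then 1 else 0) →
    Equiv.Perm.sign σ ^ t.card * Equiv.Perm.sign ρ =
      (∏ k ∈ t, Equiv.Perm.sign (g k)) * Equiv.Perm.sign π' := by
  classical
  induction t using Finset.induction_on with
  | empty =>
    intro ρ h
    have : ρ = π' := by
      ext1 a
      have := h a (ρ a)
      by_contra hne
      simp [Ne.symm hne] at this
    simp [this]
  | insert k t hk ih =>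
    intro ρ h
    have hg : ∀ a, g k a = σ a ∨ g k a = ρ a := by
      intro a
      by_contra! hne
      have := h a (g k a)
      rw [if_neg (Ne.symm hne.1), if_neg (Ne.symm hne.2), Finset.sum_insert hk, if_pos rfl] at this
      omega
    have hinv : ∀ b, g k ((g k)⁻¹ b) = b := (g k).apply_symm_apply
    have hinv' : ∀ b, (g k)⁻¹ (g k b) = b := (g k).symm_apply_apply
    -- the induction hypothesis is for the sums without `g k` and without one copy of `σ`
    set ρ' : Equiv.Perm α := σ * (g k)⁻¹ * ρ with hρ'
    have hsplit : ∀ a b, ((if g k a = b then 1 else 0) + (if ρ' a = b then 1 else 0) : ℕ) =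
        (if σ a = b then 1 else 0) + (if ρ a = b then 1 else 0) := by
      intro a b
      by_cases hρ : g k a = ρ a
      · have : ρ' a = σ a := by
          rw [hρ', Equiv.Perm.mul_apply, ← hρ, Equiv.Perm.mul_apply, hinv']
        rw [this, hρ, add_comm]
      · have hc : g k ((g k)⁻¹ (ρ a)) = ρ a := hinv _
        have : ρ' a = ρ a := by
          rw [hρ', Equiv.Perm.mul_apply, Equiv.Perm.mul_apply]
          rcases hg ((g k)⁻¹ (ρ a)) with h1 | h1
          · rw [← h1, hc]
          · rw [hc] at h1
            rw [← ρ.injective h1] at hc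
            exact absurd hc hρ
        rw [this, (hg a).resolve_right hρ]
    have hind := ih ρ' fun a b => by
      have h1 := h a b
      have h2 := hsplit a b
      rw [Finset.sum_insert hk, Finset.card_insert_of_notMem hk, add_mul, one_mul] at h1
      omega
    rw [Finset.card_insert_of_notMem hk, Finset.prod_insert hk, mul_assoc, ← hind, hρ']
    simp only [map_mul, Equiv.Perm.sign_inv]
    have := Int.units_mul_self (Equiv.Perm.sign (g k))
    calc _ = (Equiv.Perm.sign (g k) * Equiv.Perm.sign (g k)) *
        (Equiv.Perm.sign σ ^ (t.card + 1) * Equiv.Perm.sign ρ) := by rw [this, one_mul]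
      _ = _ := by rw [pow_succ]; simp only [mul_comm, mul_left_comm, mul_assoc]

namespace SignedPoly

open SignedNat

variable {ι : Type w} {n : ℕ}

/-- The matrix of formal variables with a given pattern of indices. -/
noncomputable def varMatrix (v : Fin n → Fin n → ι) : Matrix (Fin n) (Fin n) (SignedPoly ι) :=
  Matrix.of fun i j => MvPolynomial.X (v i j)

/-- The exponent of the monomial `∏ i ∈ J, v i (π i)`. -/
noncomputable def rowExp (v : Fin n → Fin n → ι) (J : Finset (Fin n)) (π : Equiv.Perm (Fin n)) :
    ι →₀ ℕ :=
  ∑ i ∈ J, Finsupp.single (v i (π i)) 1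

theorem prod_varMatrix (v : Fin n → Fin n → ι) (J : Finset (Fin n)) (π : Equiv.Perm (Fin n)) :
    ∏ i ∈ J, varMatrix v i (π i) = MvPolynomial.monomial (rowExp v J π) 1 :=
  (MvPolynomial.monomial_sum_one _ _).symm

theorem permSign_symm (π : Equiv.Perm (Fin n)) :
    permSign (symm ι) π = MvPolynomial.C (sgn (Equiv.Perm.sign π)) := by
  unfold permSign
  rcases Int.units_eq_one_or (Equiv.Perm.sign π) with h | h
  · rw [if_pos h, h, map_one, MvPolynomial.C_1]
  · rw [h, if_neg (by decide), symm_neg_one]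

theorem symDet_varMatrix (v : Fin n → Fin n → ι) :
    symDet (symm ι) (varMatrix v) = ∑ π : Equiv.Perm (Fin n),
      MvPolynomial.monomial (rowExp v Finset.univ π) (sgn (Equiv.Perm.sign π)) := by
  refine Finset.sum_congr rfl fun π _ => ?_
  rw [permSign_symm, prod_varMatrix, MvPolynomial.C_mul_monomial, mul_one]

theorem coeff_charPoly_varMatrix (v : Fin n → Fin n → ι) (j : ℕ) :
    (charPoly (symm ι) (varMatrix v)).coeff j = ∑ x ∈ charTerms n j,
      MvPolynomial.monomial (rowExp v x.2ᶜ x.1) (sgn (Equiv.Perm.sign x.1 * (-1) ^ (n - j))) := by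
  rw [coeff_charPoly]
  refine Finset.sum_congr rfl fun x _ => ?_
  rw [permSign_symm, prod_varMatrix, symm_neg_one, map_mul, map_pow, ← MvPolynomial.C_pow,
    ← MvPolynomial.C_mul, MvPolynomial.C_mul_monomial, mul_one]

theorem varMatrix_map_eval {S : Type u} [CommSemiring S] (τ : Symmetry S) (x : ι → S)
    (v : Fin n → Fin n → ι) :
    (varMatrix v).map (eval τ x) = Matrix.of fun i j => x (v i j) := by
  ext i j
  exact eval_X τ x _

theorem toInt_symDet (M : Matrix (Fin n) (Fin n) (SignedPoly ι)) :
    toInt (symDet (symm ι) M) = (M.map toInt).det := by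
  rw [map_symDet toInt_neg_one, symDet_ofRing]

theorem toInt_adj (M : Matrix (Fin n) (Fin n) (SignedPoly ι)) :
    (adj (symm ι) M).map toInt = (M.map toInt).adjugate := by
  rw [map_adj toInt_neg_one, adj_ofRing]

theorem toInt_coeff_charPoly (M : Matrix (Fin n) (Fin n) (SignedPoly ι)) (j : ℕ) :
    toInt ((charPoly (symm ι) M).coeff j) = (M.map toInt).charpoly.coeff j := by
  rw [← coeff_map, map_charPoly toInt_neg_one, charPoly_ofRing]

theorem eval_coeff_charPoly {S : Type u} [CommSemiring S] (τ : Symmetry S) (x : ι → S)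
    (M : Matrix (Fin n) (Fin n) (SignedPoly ι)) (j : ℕ) :
    eval τ x ((charPoly (symm ι) M).coeff j) = (charPoly τ (M.map (eval τ x))).coeff j := by
  rw [← coeff_map, map_charPoly (eval_neg_one τ x)]

/-- The transfer principle for formal identities with right-hand side `± det(V) ^ N (f_W)_j`, where
`V` and `W` are matrices of variables. It applies at the points at which `det(V)` takes the value
of one of its terms, the one of `σ`, provided that the terms of the right-hand side that come from
this one do not cancel with others. -/
theorem succBal_det_pow_mul_coeff_charPoly {S : Type u} [CommSemiring S] {τ : Symmetry S}
    (anti : ∀ a b : S, NatLE a b → NatLE b a → a = b) (x : ι → S) (v w : Fin n → Fin n → ι)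
    (σ : Equiv.Perm (Fin n))
    (hσ : permSign τ σ * ∏ i, x (v i (σ i)) = symDet τ (Matrix.of fun i j => x (v i j)))
    (N j : ℕ) (ε : ℤˣ)
    (hsign : ∀ y ∈ charTerms n j, ∀ g : Fin N → Equiv.Perm (Fin n), ∀ z ∈ charTerms n j,
      N • rowExp v Finset.univ σ + rowExp w y.2ᶜ y.1 =
        (∑ k, rowExp v Finset.univ (g k)) + rowExp w z.2ᶜ z.1 →
      Equiv.Perm.sign σ ^ N * Equiv.Perm.sign y.1 =
        (∏ k, Equiv.Perm.sign (g k)) * Equiv.Perm.sign z.1)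
    (P : SignedPoly ι)
    (hP : toInt P = (ε : ℤ) • (((varMatrix v).map toInt).det ^ N *
      ((varMatrix w).map toInt).charpoly.coeff j)) :
    SuccBal τ (eval τ x P) (signHom τ ε * (symDet τ (Matrix.of fun i j => x (v i j)) ^ N *
      (charPoly τ (Matrix.of fun i j => x (w i j))).coeff j)) := by
  classical
  set D := symDet (symm ι) (varMatrix v) with hD
  set c := (charPoly (symm ι) (varMatrix w)).coeff j with hc
  set Q : SignedPoly ι := MvPolynomial.C (sgn ε) * (D ^ N * c) with hQ
  have evalD : eval τ x D = symDet τ (Matrix.of fun i j => x (v i j)) := by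
    rw [hD, map_symDet (eval_neg_one τ x), varMatrix_map_eval]
  have evalc : eval τ x c = (charPoly τ (Matrix.of fun i j => x (w i j))).coeff j := by
    rw [hc, eval_coeff_charPoly, varMatrix_map_eval]
  have evalQ : eval τ x Q = signHom τ ε * (symDet τ (Matrix.of fun i j => x (v i j)) ^ N *
      (charPoly τ (Matrix.of fun i j => x (w i j))).coeff j) := by
    rw [hQ, map_mul, eval_C, eval_sgn, map_mul, map_pow, evalD, evalc]
  set e : (Fin N → Equiv.Perm (Fin n)) × (Equiv.Perm (Fin n) × Finset (Fin n)) → ι →₀ ℕ :=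
    fun k => (∑ l, rowExp v Finset.univ (k.1 l)) + rowExp w k.2.2ᶜ k.2.1 with he
  set s : (Fin N → Equiv.Perm (Fin n)) × (Equiv.Perm (Fin n) × Finset (Fin n)) → ℤˣ :=
    fun k => ε * ((∏ l, Equiv.Perm.sign (k.1 l)) * (Equiv.Perm.sign k.2.1 * (-1) ^ (n - j))) with hs
  have hterm : ∀ k, MvPolynomial.monomial (e k) (sgn (s k)) =
      MvPolynomial.C (sgn ε) * ((∏ l, MvPolynomial.monomial (rowExp v Finset.univ (k.1 l))
        (sgn (Equiv.Perm.sign (k.1 l)))) * MvPolynomial.monomial (rowExp w k.2.2ᶜ k.2.1)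
          (sgn (Equiv.Perm.sign k.2.1 * (-1) ^ (n - j)))) := by
    intro k
    rw [← MvPolynomial.monomial_sum_prod, MvPolynomial.monomial_mul, MvPolynomial.C_mul_monomial,
      ← map_prod, ← map_mul, ← map_mul]
  rw [← evalQ]
  refine succBal_eval anti (Finset.univ ×ˢ charTerms n j) ({fun _ => σ} ×ˢ charTerms n j)
    (Finset.product_subset_product_left (Finset.subset_univ _)) e s ?_ ?_ ?_ ?_
  · rintro ⟨g, y⟩ hk ⟨g', z⟩ hl hkl
    rw [Finset.mem_product, Finset.mem_singleton] at hk
    obtain ⟨rfl, hy⟩ := hk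
    have hz := (Finset.mem_product.1 hl).2
    have := hsign y hy g' z hz (by simpa [he] using hkl)
    simp only [hs]
    rw [← mul_assoc (∏ l, _) (Equiv.Perm.sign y.1), ← mul_assoc (∏ l, _) (Equiv.Perm.sign z.1),
      ← this]
    simp
  · rw [Finset.sum_congr rfl fun k _ => hterm k, Finset.sum_product, hQ, hD, symDet_varMatrix,
      Fintype.sum_pow, hc, coeff_charPoly_varMatrix, Finset.sum_mul_sum, Finset.mul_sum]
    exact Finset.sum_congr rfl fun g _ => Finset.mul_sum _ _ _
  · rw [hP, hQ, map_mul, map_mul, map_pow, hD, hc, toInt_symDet, toInt_coeff_charPoly]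
    rw [zsmul_eq_mul]
    congr 1
    rw [toInt, MvPolynomial.map_C, toInt_sgn]
    simp
  · have hQ₁ : ∑ k ∈ ({fun _ => σ} : Finset (Fin N → Equiv.Perm (Fin n))) ×ˢ charTerms n j,
        MvPolynomial.monomial (e k) (sgn (s k)) = MvPolynomial.C (sgn ε) *
          ((permSign (symm ι) σ * ∏ i, varMatrix v i (σ i)) ^ N * c) := by
      rw [Finset.sum_congr rfl fun k _ => hterm k, Finset.sum_product, Finset.sum_singleton,
        ← Finset.mul_sum, hc, coeff_charPoly_varMatrix, permSign_symm, prod_varMatrix,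
        MvPolynomial.C_mul_monomial, mul_one]
      simp only [Finset.prod_const, Finset.card_univ, Fintype.card_fin, Finset.mul_sum]
    rw [hQ₁, evalQ, map_mul, eval_C, eval_sgn, map_mul, map_pow, evalc, map_mul,
      map_permSign (eval_neg_one τ x), map_prod]
    rw [← hσ]
    congr 4
    exact Finset.prod_congr rfl fun i _ => eval_X τ x _

end SignedPoly

namespace IsExtendedTropical

variable {S : Type u} {M : Type v} [CommSemiring S] [CommSemiring M] {τ : Symmetry S} {μ : S →+* M}

/-- An invertible sum equals one of its terms, namely one of maximal modulus. -/
theorem exists_eq_sum_of_isUnit (h : IsExtendedTropical τ μ) {κ : Type*} (K : Finset κ)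
    (hK : K.Nonempty) (f : κ → S) (hf : IsUnit (∑ k ∈ K, f k)) : ∃ k ∈ K, f k = ∑ k ∈ K, f k := by
  classical
  have hmax : ∀ a b : M, a + b = a ∨ a + b = b := by
    intro a b
    rcases h.semifield.total a b with ⟨c, rfl⟩ | ⟨c, rfl⟩
    · right; rw [← add_assoc, h.semifield.idem]
    · left; rw [add_right_comm, h.semifield.idem]
  obtain ⟨k, hk, hμ⟩ : ∃ k ∈ K, μ (f k) = ∑ k ∈ K, μ (f k) := by
    clear hf
    induction hK using Finset.Nonempty.cons_induction with
    | singleton a => exact ⟨a, Finset.mem_singleton_self a, (Finset.sum_singleton _ _).symm⟩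
    | cons a s ha hs ih =>
      obtain ⟨k, hk, ih⟩ := ih
      rw [Finset.sum_cons, ← ih]
      rcases hmax (μ (f a)) (μ (f k)) with h1 | h1 <;> rw [h1]
      · exact ⟨a, Finset.mem_cons_self a s, rfl⟩
      · exact ⟨k, Finset.mem_cons_of_mem hk, rfl⟩
  refine ⟨k, hk, h.eq_of_natLE _ _ ⟨_, (Finset.add_sum_erase K f hk).symm⟩ ?_ (.inl hf)⟩
  rw [hμ, map_sum]

theorem exists_eq_symDet (h : IsExtendedTropical τ μ) {n : ℕ} {A : Matrix (Fin n) (Fin n) S}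
    (hA : Nonsingular τ A) :
    ∃ σ : Equiv.Perm (Fin n), permSign τ σ * ∏ i, A i (σ i) = symDet τ A := by
  obtain ⟨σ, -, hσ⟩ := h.exists_eq_sum_of_isUnit _ Finset.univ_nonempty _ hA
  exact ⟨σ, hσ⟩

end IsExtendedTropical

/-! ### Conjugation and quasi-inverses over extended tropical semirings -/

namespace SignedPoly

variable {ι : Type w} {n : ℕ}

theorem rowExp_apply [DecidableEq ι] (v : Fin n → Fin n → ι) (J : Finset (Fin n))
    (π : Equiv.Perm (Fin n)) (a : ι) :
    rowExp v J π a = ∑ i ∈ J, if v i (π i) = a then 1 else 0 := by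
  simp [rowExp, Finsupp.finsetSum_apply, Finsupp.single_apply]

theorem rowExp_apply_of_injective {v : Fin n → Fin n → ι}
    (hv : Function.Injective fun p : Fin n × Fin n => v p.1 p.2) (J : Finset (Fin n))
    (π : Equiv.Perm (Fin n)) (a b : Fin n) :
    rowExp v J π (v a b) = if a ∈ J then (if π a = b then 1 else 0) else 0 := by
  classical
  have h : ∀ i, v i (π i) = v a b ↔ i = a ∧ π a = b := by
    intro i
    refine ⟨fun h => ?_, fun h => by rw [h.1, h.2]⟩
    have := hv (a₁ := (i, π i)) (a₂ := (a, b)) h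
    rw [Prod.mk.injEq] at this
    exact ⟨this.1, this.1 ▸ this.2⟩
  simp only [rowExp_apply, h, ite_and, Finset.sum_ite_eq']

/-- Two terms of a coefficient of the characteristic polynomial have the same monomial only if they
have the same permutation. -/
theorem eq_of_rowExp_compl_eq {v : Fin n → Fin n → ι}
    (hv : Function.Injective fun p : Fin n × Fin n => v p.1 p.2) {j : ℕ}
    {y z : Equiv.Perm (Fin n) × Finset (Fin n)} (hy : y ∈ charTerms n j) (hz : z ∈ charTerms n j)
    (h : ∀ a b, rowExp v y.2ᶜ y.1 (v a b) = rowExp v z.2ᶜ z.1 (v a b)) : y.1 = z.1 := by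
  rw [mem_charTerms] at hy hz
  ext1 a
  have h1 := h a (y.1 a)
  have h2 := h a (z.1 a)
  simp only [rowExp_apply_of_injective hv, Finset.mem_compl] at h1 h2
  by_cases hay : a ∈ y.2 <;> by_cases haz : a ∈ z.2
  · rw [hy.2 a hay, hz.2 a haz]
  · simp [hay, haz] at h2
  · simp [hay, haz] at h1
  · simpa [hay, haz, eq_comm] using h1

/-- The terms of `det(V) ^ N` times a coefficient of the characteristic polynomial of the same
matrix `V` of variables that involve the `N`-th power of one term of `det(V)` do not cancel. -/
theorem sign_eq_of_rowExp_eq {v : Fin n → Fin n → ι}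
    (hv : Function.Injective fun p : Fin n × Fin n => v p.1 p.2) {N j : ℕ}
    (σ : Equiv.Perm (Fin n)) (g : Fin N → Equiv.Perm (Fin n))
    {y z : Equiv.Perm (Fin n) × Finset (Fin n)} (hy : y ∈ charTerms n j) (hz : z ∈ charTerms n j)
    (h : N • rowExp v Finset.univ σ + rowExp v y.2ᶜ y.1 =
        (∑ k, rowExp v Finset.univ (g k)) + rowExp v z.2ᶜ z.1) :
    Equiv.Perm.sign σ ^ N * Equiv.Perm.sign y.1 =
        (∏ k, Equiv.Perm.sign (g k)) * Equiv.Perm.sign z.1 := by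
  have h1 : ∀ a b, N * (if σ a = b then 1 else 0) +
      (if a ∈ y.2 then 0 else if y.1 a = b then 1 else 0) =
      (∑ k, if g k a = b then 1 else 0) +
        if a ∈ z.2 then 0 else if z.1 a = b then 1 else 0 := by
    intro a b
    have := DFunLike.congr_fun h (v a b)
    simpa [rowExp_apply_of_injective hv, Finsupp.finsetSum_apply] using this
  -- the row sums determine the set of rows that the second factor uses
  have h2 : y.2 = z.2 := by
    ext a
    have := Finset.sum_congr (rfl : (Finset.univ : Finset (Fin n)) = Finset.univ)
      fun b _ => h1 a b
    simp only [Finset.sum_add_distrib] at this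
    rw [Finset.sum_comm] at this
    by_cases hay : a ∈ y.2 <;> by_cases haz : a ∈ z.2 <;> simp_all
  rw [mem_charTerms] at hy hz
  have := sign_eq_of_permMatrix_add_eq Finset.univ σ z.1 g y.1 fun a b => by
    have := h1 a b
    rw [Finset.card_univ, Fintype.card_fin]
    by_cases ha : a ∈ z.2
    · simp only [h2, ha, if_true] at this
      rw [hy.2 a (h2 ▸ ha), hz.2 a ha]
      omega
    · simpa only [h2, ha, if_false] using this
  rwa [Finset.card_univ, Fintype.card_fin] at this

end SignedPoly

open SignedPoly SignedNat

namespace IsExtendedTropical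

variable {S : Type u} {M : Type v} [CommSemiring S] [CommSemiring M] {τ : Symmetry S} {μ : S →+* M}
  {n : ℕ}

theorem succBal_coeff_charPoly_adj_conj (h : IsExtendedTropical τ μ)
    (A E : Matrix (Fin n) (Fin n) S) (hE : Nonsingular τ E) (j : ℕ) :
    SuccBal τ ((charPoly τ (adj τ E * A * E)).coeff j)
      (symDet τ E ^ (n - j) * (charPoly τ A).coeff j) := by
  obtain ⟨σ, hσ⟩ := h.exists_eq_symDet hE
  set v : Fin n → Fin n → (Fin n × Fin n) ⊕ (Fin n × Fin n) := fun i k => .inl (i, k) with hv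
  set w : Fin n → Fin n → (Fin n × Fin n) ⊕ (Fin n × Fin n) := fun i k => .inr (i, k) with hw
  set x : (Fin n × Fin n) ⊕ (Fin n × Fin n) → S :=
    Sum.elim (fun p => E p.1 p.2) (fun p => A p.1 p.2)
  have hv' : Function.Injective fun p : Fin n × Fin n => v p.1 p.2 := Sum.inl_injective
  have hw' : Function.Injective fun p : Fin n × Fin n => w p.1 p.2 := Sum.inr_injective
  have hvx : (varMatrix v).map (eval τ x) = E := by rw [varMatrix_map_eval]; rfl
  have hwx : (varMatrix w).map (eval τ x) = A := by rw [varMatrix_map_eval]; rfl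
  have key := succBal_det_pow_mul_coeff_charPoly (τ := τ) h.natLE_antisymm x v w σ hσ (n - j) j 1
    (fun y hy g z hz hyz => by
      have hvw : ∀ J π a b, rowExp v J π (w a b) = 0 := fun J π a b => by
        classical
        simp [rowExp_apply, hv, hw]
      have hwv : ∀ J π a b, rowExp w J π (v a b) = 0 := fun J π a b => by
        classical
        simp [rowExp_apply, hv, hw]
      have h1 : y.1 = z.1 := eq_of_rowExp_compl_eq hw' hy hz fun a b => by
        have := DFunLike.congr_fun hyz (w a b)
        simpa [Finsupp.finsetSum_apply, hvw] using this
      have h2 : ∀ k, g k = σ := fun k => by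
        ext1 a
        have := DFunLike.congr_fun hyz (v a (σ a))
        simp only [Finsupp.add_apply, Finsupp.smul_apply, Finsupp.finsetSum_apply, hwv,
          rowExp_apply_of_injective hv', Finset.mem_univ, if_true, smul_eq_mul, add_zero, mul_one]
          at this
        by_contra hne
        have hlt : ∑ k, (if g k a = σ a then 1 else 0) < ∑ _k : Fin (n - j), 1 :=
          Finset.sum_lt_sum (fun l _ => by split_ifs <;> omega)
            ⟨k, Finset.mem_univ k, by rw [if_neg hne]; omega⟩
        rw [← this] at hlt
        simp at hlt
      simp [h1, h2])
    ((charPoly (symm _) (adj (symm _) (varMatrix v) * varMatrix w * varMatrix v)).coeff j)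
    (by rw [toInt_coeff_charPoly, Matrix.map_mul, Matrix.map_mul, toInt_adj,
          coeff_charpoly_adjugate_conj]; simp)
  rw [eval_coeff_charPoly, Matrix.map_mul, Matrix.map_mul, map_adj (eval_neg_one τ x), hvx, hwx,
    map_one, one_mul] at key
  exact key

theorem succBal_symDet_mul_coeff_charPoly_adj (h : IsExtendedTropical τ μ)
    (A : Matrix (Fin n) (Fin n) S) (hA : Nonsingular τ A) {j : ℕ} (hj : j ≤ n) :
    SuccBal τ (symDet τ A * (charPoly τ (adj τ A)).coeff (n - j))
      (τ.neg 1 ^ n * (symDet τ A ^ j * (charPoly τ A).coeff j)) := by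
  obtain ⟨σ, hσ⟩ := h.exists_eq_symDet hA
  set v : Fin n → Fin n → Fin n × Fin n := fun i k => (i, k)
  set x : Fin n × Fin n → S := fun p => A p.1 p.2
  have hv' : Function.Injective fun p : Fin n × Fin n => v p.1 p.2 := fun _ _ h => h
  have hvx : (varMatrix v).map (eval τ x) = A := by rw [varMatrix_map_eval]; rfl
  have key := succBal_det_pow_mul_coeff_charPoly (τ := τ) h.natLE_antisymm x v v σ hσ j j
    ((-1) ^ n) (fun y hy g z hz hyz => sign_eq_of_rowExp_eq hv' σ g hy hz hyz)
    (symDet (symm _) (varMatrix v) *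
      (charPoly (symm _) (adj (symm _) (varMatrix v))).coeff (n - j))
    (by rw [map_mul, toInt_coeff_charPoly, toInt_symDet, toInt_adj,
          det_mul_coeff_charpoly_adjugate _ hj]; simp)
  rw [map_mul, eval_coeff_charPoly, map_symDet (eval_neg_one τ x), map_adj (eval_neg_one τ x), hvx,
    map_pow, signHom_neg_one] at key
  exact key

theorem polySuccBal_charPoly_quasiInv_conj (h : IsExtendedTropical τ μ)
    (A E : Matrix (Fin n) (Fin n) S) (hE : Nonsingular τ E) :
    PolySuccBal τ (charPoly τ (quasiInv τ E * A * E)) (charPoly τ A) := by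
  intro j
  have key := (h.succBal_coeff_charPoly_adj_conj A E hE j).mul_left
    (Ring.inverse (symDet τ E) ^ (n - j))
  rwa [← mul_assoc, ← mul_pow, Ring.inverse_mul_cancel _ hE, one_pow, one_mul,
    ← coeff_charPoly_smul, ← Matrix.smul_mul, ← Matrix.smul_mul] at key

theorem succBal_coeff_charPoly_quasiInv (h : IsExtendedTropical τ μ)
    (A : Matrix (Fin n) (Fin n) S) (hA : Nonsingular τ A) {j : ℕ} (hj : j ≤ n) :
    SuccBal τ ((charPoly τ (quasiInv τ A)).coeff (n - j))
      (τ.neg 1 ^ n * Ring.inverse (symDet τ A) * (charPoly τ A).coeff j) := by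
  have key := (h.succBal_symDet_mul_coeff_charPoly_adj A hA hj).mul_left
    (Ring.inverse (symDet τ A) ^ (j + 1))
  rw [quasiInv, coeff_charPoly_smul, Nat.sub_sub_self hj]
  have hu := Ring.inverse_mul_cancel _ hA
  have hu' : Ring.inverse (symDet τ A) ^ j * symDet τ A ^ j = 1 := by
    rw [← mul_pow, hu, one_pow]
  generalize Ring.inverse (symDet τ A) = u at *
  generalize symDet τ A = d at *
  convert key using 1
  · rw [pow_succ, mul_assoc, ← mul_assoc u d, hu, one_mul]
  · calc _ = τ.neg 1 ^ n * u * (u ^ j * d ^ j) * (charPoly τ A).coeff j := by rw [hu', mul_one]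
      _ = _ := by ring

end IsExtendedTropical

section Laurent

variable {S : Type u} [CommSemiring S]

theorem coeff_toLaurent_natCast (p : S[X]) (k : ℕ) :
    (toLaurent p).coeff (k : ℤ) = p.coeff k := by
  rw [LaurentPolynomial.coeff_toLaurent]
  exact Finsupp.mapDomain_apply Nat.castEmbedding.injective _ _

theorem coeff_toLaurent_of_neg (p : S[X]) {k : ℤ} (hk : k < 0) :
    (toLaurent p).coeff k = 0 := by
  rw [LaurentPolynomial.coeff_toLaurent]
  refine Finsupp.mapDomain_of_notMem_range _ _ ?_
  rintro ⟨l, rfl⟩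
  simp at hk
  omega

theorem coeff_C_mul_T_mul (b : S) (n : ℤ) (f : LaurentPolynomial S) (k : ℤ) :
    (LaurentPolynomial.C b * LaurentPolynomial.T n * f).coeff k = b * f.coeff (k - n) := by
  rw [← LaurentPolynomial.single_eq_C_mul_T]
  exact AddMonoidAlgebra.coeff_single_mul_eq_mul_coeff _ fun m _ => by omega

end Laurent

theorem IsExtendedTropical.laurentSuccBal_charPoly_quasiInv {S : Type u} {M : Type v}
    [CommSemiring S] [CommSemiring M] {τ : Symmetry S} {μ : S →+* M} {n : ℕ}
    (h : IsExtendedTropical τ μ) (A : Matrix (Fin n) (Fin n) S) (hA : Nonsingular τ A) :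
    LaurentSuccBal τ (toLaurent (charPoly τ (quasiInv τ A)))
      (LaurentPolynomial.C (τ.neg 1 ^ n * Ring.inverse (symDet τ A)) *
        LaurentPolynomial.T (n : ℤ) * LaurentPolynomial.invert (toLaurent (charPoly τ A))) := by
  intro k
  rw [coeff_C_mul_T_mul, LaurentPolynomial.invert_apply, neg_sub]
  rcases lt_or_ge k 0 with hk | hk
  · obtain ⟨l, hl⟩ := Int.eq_ofNat_of_zero_le (show 0 ≤ (n : ℤ) - k by omega)
    rw [coeff_toLaurent_of_neg _ hk, hl, coeff_toLaurent_natCast,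
      coeff_charPoly_of_lt _ _ (by omega), mul_zero]
    exact .refl τ _
  · lift k to ℕ using hk
    rcases le_or_gt k n with hkn | hkn
    · obtain ⟨j, rfl⟩ := Nat.exists_eq_add_of_le hkn
      have key := h.succBal_coeff_charPoly_quasiInv A hA (Nat.le_add_left j k)
      rw [Nat.add_sub_cancel] at key
      rw [show ((k + j : ℕ) : ℤ) - k = (j : ℕ) by omega, coeff_toLaurent_natCast,
        coeff_toLaurent_natCast]
      exact key
    · rw [coeff_toLaurent_natCast, coeff_charPoly_of_lt _ _ hkn,
        coeff_toLaurent_of_neg _ (by omega), mul_zero]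
      exact .refl τ _

/-! ### Powers of matrices for the identity symmetry -/

section Doubling

variable {S : Type u} [CommSemiring S]

/-- In a semiring in which `a ⊕ a` absorbs `a`, the terms of a sum that occur at least twice
contribute a balanced element. -/
theorem succBal_sum_filter (h3 : ∀ a : S, a + a + a = a + a) {κ : Type*} (K : Finset κ)
    (p : κ → Prop) [DecidablePred p] (f : κ → S)
    (hp : ∀ k ∈ K, ¬ p k → ∃ l ∈ K, l ≠ k ∧ f l = f k) :
    SuccBal (Symmetry.id S) (∑ k ∈ K, f k) (∑ k ∈ K with p k, f k) := by
  classical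
  have habs : ∀ k ∈ K, ¬ p k → ∑ k ∈ K, f k + f k = ∑ k ∈ K, f k := by
    intro k hk hpk
    obtain ⟨l, hl, hlk, hf⟩ := hp k hk hpk
    rw [← Finset.add_sum_erase K f hk, ← Finset.add_sum_erase (K.erase k) f
      (Finset.mem_erase.2 ⟨hlk, hl⟩), hf]
    have := h3 (f k)
    generalize ∑ x ∈ (K.erase k).erase l, f x = r
    calc _ = f k + f k + f k + r := by ring
      _ = _ := by rw [this]; ring
  have habs' : ∀ L ⊆ K.filter fun k => ¬ p k, ∑ k ∈ K, f k + ∑ k ∈ L, f k = ∑ k ∈ K, f k := by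
    intro L hL
    induction L using Finset.induction_on with
    | empty => simp
    | insert k L hk ih =>
      have := Finset.mem_filter.1 (hL (Finset.mem_insert_self k L))
      rw [Finset.sum_insert hk, ← add_assoc, habs k this.1 this.2,
        ih fun l hl => hL (Finset.mem_insert_of_mem hl)]
  refine .intro (∑ k ∈ K with ¬ p k, f k) ?_
  conv_lhs => rw [← habs' _ subset_rfl, ← Finset.sum_filter_add_sum_filter_not K p f]
  rw [add_assoc]
  rfl

end Doubling

section ClosedWalks

variable {S : Type u} [CommSemiring S] {κ : Type*} [Fintype κ] [DecidableEq κ]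

/-- Entries of a power as sums over walks, given by their inner vertices `p`. -/
theorem pow_succ_apply_eq_sum (B : Matrix κ κ S) (m : ℕ) (i j : κ) :
    (B ^ (m + 1)) i j = ∑ p : Fin m → κ,
      ∏ s : Fin (m + 1), B (Fin.cons (α := fun _ => κ) i p s) (Fin.snoc (α := fun _ => κ) p j s) := by
  induction m generalizing i with
  | zero => simp [Fin.snoc]
  | succ m ih =>
    rw [pow_succ', Matrix.mul_apply, ← (Fin.consEquiv fun _ : Fin (m + 1) => κ).sum_comp,
      Fintype.sum_prod_type]
    refine Finset.sum_congr rfl fun l _ => ?_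
    rw [ih, Finset.mul_sum]
    refine Finset.sum_congr rfl fun p _ => ?_
    symm
    rw [show Fin.consEquiv (fun _ : Fin (m + 1) => κ) (l, p) = Fin.cons (α := fun _ => κ) l p from
      rfl, Fin.prod_univ_succ, ← Fin.cons_snoc_eq_snoc_cons]
    simp only [Fin.cons_zero, Fin.cons_succ]

/-- The trace of a power as a sum over closed walks; `s + 1` is taken modulo the length. -/
theorem trace_pow_succ_eq_sum (B : Matrix κ κ S) (m : ℕ) :
    (B ^ (m + 1)).trace = ∑ q : Fin (m + 1) → κ, ∏ s, B (q s) (q (s + 1)) := by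
  rw [← (Fin.consEquiv fun _ : Fin (m + 1) => κ).sum_comp, Fintype.sum_prod_type, Matrix.trace]
  refine Finset.sum_congr rfl fun i _ => ?_
  rw [Matrix.diag_apply, pow_succ_apply_eq_sum]
  refine Finset.sum_congr rfl fun p _ => Finset.prod_congr rfl fun s _ => ?_
  simp only [Fin.consEquiv_apply]
  congr 1
  refine Fin.lastCases ?_ (fun t => ?_) s
  · rw [Fin.snoc_last, Fin.last_add_one, Fin.cons_zero]
  · rw [Fin.snoc_castSucc, Fin.coeSucc_eq_succ, Fin.cons_succ]

/-- Only the constant closed walks are invariant under rotation, so the others come with a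
different closed walk of the same weight. -/
theorem succBal_trace_pow (h3 : ∀ a : S, a + a + a = a + a) (B : Matrix κ κ S) (m : ℕ) :
    SuccBal (Symmetry.id S) (B ^ m).trace (∑ i, B i i ^ m) := by
  cases m with
  | zero => exact .of_eq (by simp [Matrix.trace])
  | succ m =>
    rw [trace_pow_succ_eq_sum]
    refine (succBal_sum_filter h3 Finset.univ (fun q => (fun s => q (s + 1)) = q) _ ?_).trans
      (.of_eq ?_)
    · intro q _ hq
      refine ⟨fun s => q (s + 1), Finset.mem_univ _, hq, ?_⟩
      exact Equiv.prod_comp (Equiv.addRight (1 : Fin (m + 1))) fun s => B (q s) (q (s + 1))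
    · refine (Finset.sum_nbij' (fun i _ => i) (fun q => q 0) ?_ ?_ ?_ ?_ ?_).symm
      · simp
      · simp
      · simp
      · intro q hq
        have hq : ∀ s, q (s + 1) = q s := congr_fun (Finset.mem_filter.1 hq).2
        funext s
        refine Fin.induction rfl (fun t ht => ?_) s
        rw [← Fin.coeSucc_eq_succ, hq]
        exact ht
      · simp

end ClosedWalks

section Compound

variable {S : Type u} [CommSemiring S] {n : ℕ}

/-- The `k`-th compound matrix for the identity symmetry: its entries are the permanents of the
`k × k` submatrices, as sums over the bijections between the row set and the column set. -/
def compound (k : ℕ) (A : Matrix (Fin n) (Fin n) S) :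
    Matrix {I : Finset (Fin n) // I.card = k} {I : Finset (Fin n) // I.card = k} S :=
  Matrix.of fun I J => ∑ e : I.1 ≃ J.1, ∏ i : I.1, A i (e i)

theorem compound_one (k : ℕ) : compound k (1 : Matrix (Fin n) (Fin n) S) = 1 := by
  ext I J
  by_cases hIJ : I = J
  · subst hIJ
    rw [Matrix.one_apply_eq]
    refine (Finset.sum_eq_single (Equiv.refl _) (fun e _ he => ?_) (by simp)).trans
      (Finset.prod_eq_one fun i _ => Matrix.one_apply_eq _)
    obtain ⟨i, hi⟩ : ∃ i, e i ≠ i := by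
      by_contra! h
      exact he (Equiv.ext h)
    exact Finset.prod_eq_zero (Finset.mem_univ i)
      (Matrix.one_apply_ne fun h => hi (Subtype.ext h.symm))
  · rw [Matrix.one_apply_ne hIJ]
    refine Finset.sum_eq_zero fun e _ => ?_
    obtain ⟨i, hi, hiJ⟩ : ∃ i ∈ I.1, i ∉ J.1 := by
      by_contra! h
      exact hIJ (Subtype.ext (Finset.eq_of_subset_of_card_le h (by rw [I.2, J.2])))
    refine Finset.prod_eq_zero (Finset.mem_univ ⟨i, hi⟩) (Matrix.one_apply_ne fun h => hiJ ?_)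
    rw [show i = (e ⟨i, hi⟩ : Fin n) from h]
    exact (e ⟨i, hi⟩).2

/-- The weak Cauchy-Binet formula: the terms that do not come from the product of the compound
matrices visit some intermediate index twice, and exchanging the end points of the two paths
yields another term of the same weight. -/
theorem succBal_compound_mul (h3 : ∀ a : S, a + a + a = a + a) (k : ℕ)
    (A B : Matrix (Fin n) (Fin n) S) (I J : {I : Finset (Fin n) // I.card = k}) :
    SuccBal (Symmetry.id S) (compound k (A * B) I J) ((compound k A * compound k B) I J) := by
  classical
  have expand : compound k (A * B) I J = ∑ x : (I.1 ≃ J.1) × (I.1 → Fin n),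
      ∏ i : I.1, A i (x.2 i) * B (x.2 i) (x.1 i) := by
    rw [Fintype.sum_prod_type]
    refine Finset.sum_congr rfl fun e _ => ?_
    simp only [Matrix.mul_apply]
    exact Fintype.prod_sum _
  rw [expand]
  refine (succBal_sum_filter h3 Finset.univ (fun x => Function.Injective x.2) _ ?_).trans
    (.of_eq ?_)
  · rintro ⟨e, g⟩ - hg
    obtain ⟨a, b, hab, hne⟩ : ∃ a b, g a = g b ∧ a ≠ b := by
      simpa [Function.Injective] using hg
    have hswap : ∀ i, g (Equiv.swap a b i) = g i := by
      intro i
      by_cases ha : i = a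
      · rw [ha, Equiv.swap_apply_left, hab]
      · by_cases hb : i = b
        · rw [hb, Equiv.swap_apply_right, hab]
        · rw [Equiv.swap_apply_of_ne_of_ne ha hb]
    refine ⟨((Equiv.swap a b).trans e, g), Finset.mem_univ _, fun h => ?_, ?_⟩
    · have := Equiv.congr_fun (congrArg Prod.fst h) a
      simp only [Equiv.trans_apply, Equiv.swap_apply_left] at this
      exact hne (e.injective this).symm
    · simp only [Finset.prod_mul_distrib, Equiv.trans_apply]
      congr 1
      rw [← Equiv.prod_comp (Equiv.swap a b) fun i => B (g i) (e i)]
      simp only [hswap]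
  · have hprod : (compound k A * compound k B) I J =
        ∑ y : Σ L : {I : Finset (Fin n) // I.card = k}, (I.1 ≃ L.1) × (L.1 ≃ J.1),
          (∏ i : I.1, A i (y.2.1 i)) * ∏ l : y.1.1, B l (y.2.2 l) := by
      rw [Fintype.sum_sigma, Matrix.mul_apply]
      refine Finset.sum_congr rfl fun L _ => ?_
      rw [Fintype.sum_prod_type]
      exact Finset.sum_mul_sum _ _ _ _
    rw [hprod]
    symm
    refine Finset.sum_bij (fun y _ => (y.2.1.trans y.2.2, fun i => (y.2.1 i : Fin n))) ?_ ?_ ?_ ?_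
    · rintro ⟨L, a, b⟩ -
      rw [Finset.mem_filter]
      exact ⟨Finset.mem_univ _, fun i j h => a.injective (Subtype.ext h)⟩
    · rintro ⟨L, a, b⟩ - ⟨L', a', b'⟩ - h
      rw [Prod.mk.injEq] at h
      obtain ⟨h1, h2⟩ := h
      have hL : L = L' := by
        refine Subtype.ext (Finset.eq_of_subset_of_card_le (fun l hl => ?_) (by rw [L.2, L'.2]))
        have := congr_fun h2 (a.symm ⟨l, hl⟩)
        simp only [Equiv.apply_symm_apply] at this
        rw [this]
        exact (a' _).2
      subst hL
      obtain rfl : a = a' := Equiv.ext fun i => Subtype.ext (congr_fun h2 i)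
      obtain rfl : b = b' := Equiv.ext fun l => by
        simpa using Equiv.congr_fun h1 (a.symm l)
      rfl
    · rintro ⟨e, g⟩ hg
      have hg : Function.Injective g := (Finset.mem_filter.1 hg).2
      have hcard : (Finset.univ.image g).card = k := by
        rw [Finset.card_image_of_injective _ hg, Finset.card_univ, Fintype.card_coe, I.2]
      set a : I.1 ≃ (Finset.univ.image g : Finset (Fin n)) := Equiv.ofBijective
        (fun i => ⟨g i, Finset.mem_image_of_mem g (Finset.mem_univ i)⟩)
        ⟨fun i j h => hg (congrArg Subtype.val h), fun l => by
          obtain ⟨i, -, hi⟩ := Finset.mem_image.1 l.2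
          exact ⟨i, Subtype.ext hi⟩⟩
      refine ⟨⟨⟨Finset.univ.image g, hcard⟩, a, a.symm.trans e⟩, Finset.mem_univ _, ?_⟩
      refine Prod.ext ?_ rfl
      exact Equiv.ext fun i => congrArg e (a.symm_apply_apply i)
    · rintro ⟨L, a, b⟩ -
      rw [Finset.prod_mul_distrib, ← Equiv.prod_comp a fun l : L.1 => B l (b l)]
      rfl

theorem succBal_compound_pow (h3 : ∀ a : S, a + a + a = a + a) (k : ℕ)
    (A : Matrix (Fin n) (Fin n) S) (m : ℕ) (I J : {I : Finset (Fin n) // I.card = k}) :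
    SuccBal (Symmetry.id S) (compound k (A ^ m) I J) ((compound k A ^ m) I J) := by
  induction m generalizing I J with
  | zero => rw [pow_zero, pow_zero, compound_one]; exact .refl _ _
  | succ m ih =>
    rw [pow_succ, pow_succ]
    refine (succBal_compound_mul h3 k _ A I J).trans ?_
    rw [Matrix.mul_apply, Matrix.mul_apply]
    exact SuccBal.sum _ fun L _ => (ih I L).mul (.refl _ _)

theorem coeff_charPoly_id (A : Matrix (Fin n) (Fin n) S) {j : ℕ} (hj : j ≤ n) :
    (charPoly (Symmetry.id S) A).coeff j = (compound (n - j) A).trace := by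
  classical
  have h1 : (compound (n - j) A).trace =
      ∑ y : Σ I : {I : Finset (Fin n) // I.card = n - j}, Equiv.Perm I.1,
        ∏ i : y.1.1, A i (y.2 i) := by
    rw [Fintype.sum_sigma]
    rfl
  have h2 : ∀ σ : Equiv.Perm (Fin n), permSign (Symmetry.id S) σ = 1 := fun σ => ite_self _
  rw [coeff_charPoly, h1]
  symm
  refine Finset.sum_bij (fun y _ => (Equiv.Perm.ofSubtype y.2, y.1.1ᶜ)) ?_ ?_ ?_ ?_
  · rintro ⟨I, e⟩ -
    rw [mem_charTerms, Finset.card_compl, Fintype.card_fin, I.2, Nat.sub_sub_self hj]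
    exact ⟨rfl, fun i hi => Equiv.Perm.ofSubtype_apply_of_not_mem e (Finset.mem_compl.1 hi)⟩
  · rintro ⟨I, e⟩ - ⟨I', e'⟩ - h
    rw [Prod.mk.injEq] at h
    obtain rfl : I = I' := Subtype.ext (compl_injective h.2)
    obtain rfl : e = e' := Equiv.Perm.ofSubtype_injective h.1
    rfl
  · rintro ⟨π, J⟩ hx
    rw [mem_charTerms] at hx
    have hJ : ∀ i, π i ∈ Jᶜ ↔ i ∈ Jᶜ := by
      intro i
      rw [Finset.mem_compl, Finset.mem_compl, not_iff_not]
      refine ⟨fun h => ?_, fun h => (hx.2 i h).symm ▸ h⟩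
      rwa [← π.injective (hx.2 _ h)]
    refine ⟨⟨⟨Jᶜ, by rw [Finset.card_compl, Fintype.card_fin, hx.1]⟩, π.subtypePerm hJ⟩,
      Finset.mem_univ _, ?_⟩
    refine Prod.ext ?_ (compl_compl J)
    exact Equiv.Perm.ofSubtype_subtypePerm hJ fun i hi => Finset.mem_compl.2 fun h => hi (hx.2 i h)
  · rintro ⟨I, e⟩ -
    rw [h2, show (Symmetry.id S).neg 1 = 1 from rfl, one_pow, one_mul, one_mul, compl_compl]
    refine Eq.trans ?_ (Finset.prod_coe_sort I.1 fun i => A i (Equiv.Perm.ofSubtype e i))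
    exact Finset.prod_congr rfl fun i _ => by rw [Equiv.Perm.ofSubtype_apply_coe]

end Compound

section Powers

variable {S : Type u} [CommSemiring S] {n : ℕ}

/-- For `m = 0` the left-hand side is a positive multiple of `1`, hence `1` or `1 ⊕ 1°`; for
`m ≥ 1` the two sides are equal. -/
theorem succBal_sum_pow (h3 : ∀ a : S, a + a + a = a + a)
    (hF : ∀ (a b : S) (m : ℕ), (a + b) ^ (m + 1) = a ^ (m + 1) + b ^ (m + 1))
    {κ : Type*} {K : Finset κ} (hK : K.Nonempty) (f : κ → S) (m : ℕ) :
    SuccBal (Symmetry.id S) (∑ k ∈ K, f k ^ m) ((∑ k ∈ K, f k) ^ m) := by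
  classical
  cases m with
  | zero =>
    have h : ∀ N : ℕ, SuccBal (Symmetry.id S) ((N + 1 : ℕ) : S) 1 := by
      intro N
      rcases N with _ | N
      · exact .of_eq (by simp)
      · refine .intro 1 ?_
        change _ = 1 + (1 + 1)
        induction N with
        | zero => rw [← add_assoc, h3]; norm_num
        | succ N ih => rw [Nat.cast_succ, ih, ← add_assoc, h3, h3]
    obtain ⟨N, hN⟩ := Nat.exists_eq_succ_of_ne_zero (Finset.card_ne_zero.2 hK)
    simpa [hN] using h N
  | succ m =>
    refine .of_eq ?_
    induction hK using Finset.Nonempty.cons_induction with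
    | singleton a => simp
    | cons a s ha hs ih => rw [Finset.sum_cons, Finset.sum_cons, hF, ih]

theorem succBal_coeff_charPoly_pow (h3 : ∀ a : S, a + a + a = a + a)
    (hF : ∀ (a b : S) (m : ℕ), (a + b) ^ (m + 1) = a ^ (m + 1) + b ^ (m + 1))
    (A : Matrix (Fin n) (Fin n) S) (m : ℕ) {j : ℕ} (hj : j ≤ n) :
    SuccBal (Symmetry.id S) ((charPoly (Symmetry.id S) (A ^ m)).coeff j)
      ((charPoly (Symmetry.id S) A).coeff j ^ m) := by
  rw [coeff_charPoly_id _ hj, coeff_charPoly_id _ hj]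
  refine (SuccBal.sum _ fun I _ => succBal_compound_pow h3 (n - j) A m I I).trans ?_
  refine (succBal_trace_pow h3 (compound (n - j) A) m).trans ?_
  obtain ⟨I, -, hI⟩ := Finset.exists_subset_card_eq (s := (Finset.univ : Finset (Fin n)))
    (n := n - j) (by simp)
  exact succBal_sum_pow h3 hF ⟨⟨I, hI⟩, Finset.mem_univ _⟩ _ m

theorem polySuccBal_charPoly_pow (h3 : ∀ a : S, a + a + a = a + a)
    (hF : ∀ (a b : S) (m : ℕ), (a + b) ^ (m + 1) = a ^ (m + 1) + b ^ (m + 1))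
    (A : Matrix (Fin n) (Fin n) S) (m : ℕ) :
    PolySuccBal (Symmetry.id S) (charPoly (Symmetry.id S) (A ^ m))
      (∑ k ∈ Finset.range (n + 1), C ((charPoly (Symmetry.id S) A).coeff k ^ m) * X ^ k) := by
  intro j
  simp only [finsetSum_coeff, coeff_C_mul_X_pow]
  rw [Finset.sum_ite_eq]
  split_ifs with hj
  · exact succBal_coeff_charPoly_pow h3 hF A m (by simpa [Nat.lt_succ_iff] using hj)
  · rw [coeff_charPoly_of_lt _ _ (by simpa [Nat.lt_succ_iff] using hj)]
    exact .refl _ _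

theorem charFun_eq_sum (τ : Symmetry S) (A : Matrix (Fin n) (Fin n) S) (x : S) :
    charFun τ A x = ∑ k ∈ Finset.range (n + 1), (charPoly τ A).coeff k * x ^ k := by
  rw [← eval_charPoly, eval_eq_sum_range' (n := n + 1)]
  rw [Nat.lt_succ_iff, natDegree_le_iff_coeff_eq_zero]
  exact fun k hk => coeff_charPoly_of_lt _ _ hk

theorem succBal_charFun_pow (h3 : ∀ a : S, a + a + a = a + a)
    (hF : ∀ (a b : S) (m : ℕ), (a + b) ^ (m + 1) = a ^ (m + 1) + b ^ (m + 1))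
    (A : Matrix (Fin n) (Fin n) S) (m : ℕ) (x : S) :
    SuccBal (Symmetry.id S) (charFun (Symmetry.id S) (A ^ m) (x ^ m))
      (charFun (Symmetry.id S) A x ^ m) := by
  rw [charFun_eq_sum, charFun_eq_sum]
  refine (SuccBal.sum _ fun k hk => ?_).trans
    (succBal_sum_pow h3 hF Finset.nonempty_range_add_one _ m)
  rw [mul_pow, pow_right_comm]
  exact (succBal_coeff_charPoly_pow h3 hF A m (by simpa [Nat.lt_succ_iff] using hk)).mul
    (.refl _ _)

end Powers

theorem IsTotallyOrderedIdempotentSemifield.add_pow_succ {M : Type v} [CommSemiring M]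
    (h : IsTotallyOrderedIdempotentSemifield M) (a b : M) (m : ℕ) :
    (a + b) ^ (m + 1) = a ^ (m + 1) + b ^ (m + 1) := by
  have key : ∀ {a b : M}, NatLE a b → a + b = b := by
    rintro a _ ⟨c, rfl⟩
    rw [← add_assoc, h.idem]
  rcases h.total a b with hab | hab
  · rw [key hab, key (hab.pow _)]
  · rw [add_comm, add_comm (a ^ _), key hab, key (hab.pow _)]

namespace Supertropical

theorem add_add_self (a : Supertropical) : a + a + a = a + a := by
  rw [add_of_eq rfl, add_of_eq (val_nu a), nu_nu]

theorem val_pow_lt {a b : Supertropical} (h : val a < val b) (m : ℕ) :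
    val (a ^ (m + 1)) < val (b ^ (m + 1)) := by
  induction m with
  | zero => simpa using h
  | succ m ih =>
    rw [pow_succ a, pow_succ b, val_mul, val_mul]
    calc val (a ^ (m + 1)) + val a ≤ val (b ^ (m + 1)) + val a := by gcongr
      _ < val (b ^ (m + 1)) + val b := WithBot.add_lt_add_left (ne_bot_of_gt ih) h

theorem nu_pow (a : Supertropical) (m : ℕ) : nu a ^ (m + 1) = nu (a ^ (m + 1)) := by
  induction m with
  | zero => simp
  | succ m ih =>
    rw [pow_succ, ih, mul_nu, mul_comm, mul_nu, nu_nu, mul_comm, ← pow_succ]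

theorem val_pow_congr {a b : Supertropical} (h : val a = val b) (m : ℕ) :
    val (a ^ m) = val (b ^ m) := by
  induction m with
  | zero => simp
  | succ m ih => rw [pow_succ, pow_succ, val_mul, val_mul, ih, h]

theorem add_pow_succ (a b : Supertropical) (m : ℕ) :
    (a + b) ^ (m + 1) = a ^ (m + 1) + b ^ (m + 1) := by
  rcases lt_trichotomy (val a) (val b) with h | h | h
  · rw [add_of_lt h, add_of_lt (val_pow_lt h m)]
  · rw [add_of_eq h, add_of_eq (val_pow_congr h _), nu_pow]
  · rw [add_of_gt h, add_of_gt (val_pow_lt h m)]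

end Supertropical

end SymTrop

theorem theorem6p3 :
    -- conjugates and quasi-inverses, over every extended tropical semiring
    (∀ {S : Type*} {M : Type*} [CommSemiring S] [CommSemiring M] (τ : Symmetry S) (μ : S →+* M),
      IsExtendedTropical τ μ → ∀ (n : ℕ) (A E : Matrix (Fin n) (Fin n) S),
        (Nonsingular τ E →
          PolySuccBal τ (charPoly τ (quasiInv τ E * A * E)) (charPoly τ A)) ∧
        (Nonsingular τ A →
          LaurentSuccBal τ (toLaurent (charPoly τ (quasiInv τ A)))
            (LaurentPolynomial.C (τ.neg 1 ^ n * Ring.inverse (symDet τ A)) *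
              LaurentPolynomial.T (n : ℤ) *
              LaurentPolynomial.invert (toLaurent (charPoly τ A))))) ∧
    -- powers, over every totally ordered idempotent semifield with its identity symmetry
    (∀ {M : Type*} [CommSemiring M], IsTotallyOrderedIdempotentSemifield M →
      ∀ (n : ℕ) (A : Matrix (Fin n) (Fin n) M) (m : ℕ),
        PolySuccBal (Symmetry.id M) (charPoly (Symmetry.id M) (A ^ m))
          (∑ k ∈ Finset.range (n + 1), C ((charPoly (Symmetry.id M) A).coeff k ^ m) * X ^ k) ∧
        ∀ x : M, SuccBal (Symmetry.id M) (charFun (Symmetry.id M) (A ^ m) (x ^ m))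
          (charFun (Symmetry.id M) A x ^ m)) ∧
    -- powers, over the supertropical max-plus semiring with its identity symmetry
    (∀ (n : ℕ) (A : Matrix (Fin n) (Fin n) Supertropical) (m : ℕ),
        PolySuccBal (Symmetry.id Supertropical) (charPoly (Symmetry.id Supertropical) (A ^ m))
          (∑ k ∈ Finset.range (n + 1),
            C ((charPoly (Symmetry.id Supertropical) A).coeff k ^ m) * X ^ k) ∧
        ∀ x : Supertropical, SuccBal (Symmetry.id Supertropical)
          (charFun (Symmetry.id Supertropical) (A ^ m) (x ^ m))
          (charFun (Symmetry.id Supertropical) A x ^ m)) := by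
  refine ⟨?_, ?_, ?_⟩
  · intro S M _ _ τ μ h n A E
    exact ⟨h.polySuccBal_charPoly_quasiInv_conj A E, h.laurentSuccBal_charPoly_quasiInv A⟩
  · intro M _ h n A m
    have h3 : ∀ a : M, a + a + a = a + a := fun a => by rw [h.idem, h.idem]
    exact ⟨polySuccBal_charPoly_pow h3 h.add_pow_succ A m,
      succBal_charFun_pow h3 h.add_pow_succ A m⟩
  · intro n A m
    exact ⟨polySuccBal_charPoly_pow Supertropical.add_add_self Supertropical.add_pow_succ A m,
      succBal_charFun_pow Supertropical.add_add_self Supertropical.add_pow_succ A m⟩
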